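/- **Setting.** Let $K$ be the algebra of complex rational functions $F(\tau)$ all of whose poles are integers. Then $K=\mathbb C[\tau]\oplus K_{\mathrm{Sing}}$, where $K_{\mathrm{Sing}}$ has the basis $(\tau-m)^{-l-1}$, $m\in\mathbb Z$, $l\ge 0$. Let $\mathrm{Tr}\colon K\to\mathbb C$ be the sum of the residues, and let $S(F)(\tau)=F(-\tau)$. Let $\hat H=\mathbb C[T,T^{-1},\partial]$ be the Hopf algebra with $T$ group-like and $\partial$ primitive (antipode $S(T)=T^{-1}$, $S(\partial)=-\partial$). It acts on $K$ by $(TF)(\tau)=F(\tau+1)$, $\partial=d/d\tau$, and on its dual $\hat H^*$ by $(h\varphi)(h')=\varphi(hh')$; put $(S\varphi)(h)=\varphi(S(h))$. Write $h_{m,l}=T^m\partial^l/l!$, a basis of $\hat H$, with dual functionals $h_{m,l}^*$; then $S(h_{m,l})\frac1\tau=(\tau-m)^{-l-1}$. Let $\Delta[n]=(T-1)^n/n!$ for $n\ge0$ and $\Delta[-n]=(1-T^{-1})^n/n!$ for $n>0$, let $e_{n,k}=\Delta[n]\,\partial^k/k!$ (also a basis of $\hat H$), let $e_{n,k}^*\in\hat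 H^*$ be the dual functionals, and let $$\hat K=\Bigl(\bigoplus_{n\in\mathbb Z,\,k\ge 0}\mathbb C\,e_{n,k}^*\Bigr)\oplus K_{\mathrm{Sing}} .$$ **Fields.** Let $V$ be a complex vector space. A *field* on $V$ is a linear map $f\colon K\to\mathrm{End}(V)$ (an $\mathrm{End}(V)$-valued distribution $f(\tau)$ on $K$) such that for every $v\in V$ there is $R_{f,v}\in V\otimes K_{\mathrm{Sing}}$ with $f(G)v=\mathrm{Tr}(R_{f,v}G)$ for all $G\in\mathbb C[\tau]$. The kernel $R_{f,v}=\sum R_{f,v}^{m,l}\otimes(\tau-m)^{-l-1}$ is unique. For $\varphi\in\hat H^*$ put $f(\varphi)v=\sum\varphi(h_{m,l})R_{f,v}^{m,l}$. Two fields $f,g$ are *mutually rational* if there is a nonzero polynomial $P$ such that the commutator distribution $F\otimes G\mapsto f(F)g(G)-g(G)f(F)$ on $K\otimes K$ is killed by multiplication by $P(\tau_1-\tau_2)$. **Normal ordered products.** If $A$ is a holomorphic distribution, i.e. a linear map $A\colon K_{\mathrm{Sing}}\to\mathrm{End}(V)$ (extended by $0$ to $\mathbb C[\tau]$), with Taylor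 coefficients $A_{m,l}=A((\tau-m)^{-l-1})$ at $\tau=m$, and $g$ is a field, then $A g$ is the $\mathrm{End}(V)$-valued distribution with $$(Ag)(G)v=(A g_{\mathrm{Hol}})(G)v+A(R_{g,v}G),$$ where $A g_{\mathrm{Hol}}$ vanishes on $\mathbb C[\tau]$ and $(Ag_{\mathrm{Hol}})((\tau-m)^{-l-1})=\sum_{i+j=l}A_{m,i}\,g((\tau-m)^{-j-1})$, and where $A(w\otimes F)$ means $A(F)w$. For $F\in K$ or $F\in\hat H^*$ the *$F$-th normal ordered product* of the fields $f$ and $g$ is $$f(\tau_2)_{\{F\}}g(\tau_2)=\mathrm{Tr}_{\tau_1}\Bigl(f(\tau_1)g(\tau_2)\sum_{m,l} S(h_{m,l})F\otimes h_{m,l}^*-g(\tau_2)f(\tau_1)\sum_{m,l}h_{m,l}^*\otimes S(h_{m,l}F)\Bigr).$$ That is, the first term is the product $A\,g$ of the holomorphic distribution $A$ with $A_{m,l}=f(S(h_{m,l})F)$ and the field $g$, and the second term sends $G\in K$, $v\in V$ to $\sum_{m,l}\bigl(S(h_{m,l}F)\cdot g\bigr)(G)\,R_{f,v}^{m,l}$;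 here $(C\cdot g)(G)=g(CG)$ if $C\in K$, and $C\cdot g$ is the product of the holomorphic distribution with Taylor coefficients $C(h_{m,l})\,\mathrm{id}_V$ and $g$ if $C\in\hat H^*$. For $F\in\hat K$ the product is defined by additivity over the two summands of $\hat K$. **Lemma (Dong's Lemma).** Let $a(\tau),b(\tau),c(\tau)$ be fields on $V$ that are pairwise mutually rational. Then for every $F\in\hat K$ the $F$-th normal ordered product $a(\tau)_{\{F\}}b(\tau)$ is a field on $V$, and it is mutually rational with $c(\tau)$. -/

import Mathlib

namespace HTVertex

open Polynomial TensorProduct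

noncomputable section

/-! ### The algebra `K`

Polynomial sequences `n ↦ f n` are identified with polynomials `f : ℂ[X]`; the sequence `τ` is the
variable `X`, and the translation `T` acts by `f(x) ↦ f(x + 1)`. -/

/-- The multiplicative set generated by `1` and the translates `T ^ k τ`, `k ∈ ℤ`. -/
def translates : Submonoid ℂ[X] :=
  Submonoid.closure (Set.range fun k : ℤ => (X + C (k : ℂ) : ℂ[X]))

/-- `K`: the localization of the algebra of polynomial sequences at the translates of `τ`. -/
def K : Type := Localization translates

instance : CommRing K := inferInstanceAs (CommRing (Localization translates))
instance : Algebra ℂ[X] K := inferInstanceAs (Algebra ℂ[X] (Localization translates))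
instance : Algebra ℂ K := inferInstanceAs (Algebra ℂ (Localization translates))
instance : IsScalarTower ℂ ℂ[X] K :=
  inferInstanceAs (IsScalarTower ℂ ℂ[X] (Localization translates))
instance : IsLocalization translates K :=
  inferInstanceAs (IsLocalization translates (Localization translates))

/-- The inclusion of the polynomial sequences in `K`. -/
abbrev ofPoly : ℂ[X] →ₐ[ℂ] K := IsScalarTower.toAlgHom ℂ ℂ[X] K

/-- The element `τ` of `K`. -/
def tau : K := ofPoly X

lemma X_add_mem (k : ℤ) : (X + C (k : ℂ) : ℂ[X]) ∈ translates :=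
  Submonoid.subset_closure ⟨k, rfl⟩

lemma X_sub_pow_mem (m : ℤ) (k : ℕ) : ((X - C (m : ℂ)) ^ k : ℂ[X]) ∈ translates := by
  refine pow_mem ?_ k
  have := X_add_mem (-m)
  simpa [sub_eq_add_neg] using this

/-- The index set of the basis `T ^ m ∂ ^ (l)` of `Ĥ`, with `m ∈ ℤ` and `l ≥ 0`. -/
abbrev Idx : Type := ℤ × ℕ

/-- The basic singular element `1 / (τ - m) ^ (l + 1)`, which is `S(T ^ m ∂ ^ (l)) (1 / τ)`. -/
def polar (p : Idx) : K :=
  IsLocalization.mk' K (1 : ℂ[X]) (⟨(X - C (p.1 : ℂ)) ^ (p.2 + 1), X_sub_pow_mem p.1 (p.2 + 1)⟩ :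
    translates)

/-- `K_Sing`, the span of the elements `1 / (τ - m) ^ (l + 1)`. -/
def KSing : Submodule ℂ K := Submodule.span ℂ (Set.range polar)

lemma isUnit_of_translates {A : Type*} [CommRing A] (φ : ℂ[X] →+* A)
    (h : ∀ k : ℤ, IsUnit (φ (X + C (k : ℂ)))) (y : translates) : IsUnit (φ (y : ℂ[X])) := by
  have hle : translates ≤ (IsUnit.submonoid A).comap φ := by
    refine Submonoid.closure_le.2 ?_
    rintro _ ⟨k, rfl⟩
    exact h k
  exact hle y.2

/-- The expansion `f(m + t) ∈ ℂ((t))` of a polynomial `f`. -/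
def laurentPoly (m : ℤ) : ℂ[X] →+* LaurentSeries ℂ :=
  eval₂RingHom HahnSeries.C (HahnSeries.C (m : ℂ) + HahnSeries.single 1 1)

lemma laurentPoly_eq (m : ℤ) (f : ℂ[X]) :
    laurentPoly m f =
      HahnSeries.ofPowerSeries ℤ ℂ ((taylor (m : ℂ) f : ℂ[X]) : PowerSeries ℂ) := by
  have h : laurentPoly m = (HahnSeries.ofPowerSeries ℤ ℂ).comp
      (Polynomial.coeToPowerSeries.ringHom.comp (taylorAlgHom (m : ℂ)).toRingHom) := by
    refine Polynomial.ringHom_ext (fun c => ?_) ?_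
    · simp [laurentPoly]
    · simp only [laurentPoly, coe_eval₂RingHom, eval₂_X, RingHom.comp_apply, AlgHom.toRingHom_eq_coe,
        RingHom.coe_coe, taylorAlgHom_apply, taylor_X, map_add,
        coeToPowerSeries.ringHom_apply, Polynomial.coe_X, Polynomial.coe_C,
        HahnSeries.ofPowerSeries_X, HahnSeries.ofPowerSeries_C]
      rw [add_comm]
  rw [h]
  rfl

lemma laurent_isUnit (m : ℤ) (y : translates) : IsUnit (laurentPoly m (y : ℂ[X])) := by
  refine isUnit_of_translates _ (fun k => ?_) y
  rw [isUnit_iff_ne_zero, laurentPoly_eq]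
  intro h
  rw [map_eq_zero_iff _ HahnSeries.ofPowerSeries_injective] at h
  have h1 := congrArg (PowerSeries.coeff 1) h
  rw [map_add, taylor_X, taylor_C, Polynomial.coeff_coe] at h1
  simp only [coeff_add, coeff_X_one, coeff_C_succ] at h1
  simp at h1

/-- The Laurent expansion of `F ∈ K` at the integer `m`: `F(m + t) ∈ ℂ((t))`. -/
def laurent (m : ℤ) : K →+* LaurentSeries ℂ :=
  IsLocalization.lift (M := translates) (laurent_isUnit m)

lemma shift_isUnit (m : ℤ) (y : translates) :
    IsUnit (aeval (PowerSeries.C (tau + (m : K)) + PowerSeries.X : PowerSeries K) (y : ℂ[X])) := by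
  refine isUnit_of_translates (RingHomClass.toRingHom (aeval _)) (fun k => ?_) y
  rw [PowerSeries.isUnit_iff_constantCoeff]
  have h := IsLocalization.map_units K (⟨_, X_add_mem (m + k)⟩ : translates)
  convert h using 1
  simp [tau, add_assoc]

/-- The Taylor expansion `F(τ + m + t) ∈ K[[t]]` of `F ∈ K`. -/
def shiftTaylor (m : ℤ) : K →ₐ[ℂ] PowerSeries K :=
  IsLocalization.liftAlgHom (M := translates)
    (f := aeval (PowerSeries.C (tau + (m : K)) + PowerSeries.X : PowerSeries K)) (shift_isUnit m)

/-- The action of the basis element `T ^ m ∂ ^ (l)` of `Ĥ` on `K`, where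
`∂ ^ (l) = ∂ ^ l / l!` and `∂ = d/dτ`. -/
def act (p : Idx) (F : K) : K := PowerSeries.coeff p.2 (shiftTaylor p.1 F)

/-- The action of `S(T ^ m ∂ ^ (l)) = (-1) ^ l T ^ (-m) ∂ ^ (l)` on `K`. -/
def actS (p : Idx) (F : K) : K := (-1 : ℂ) ^ p.2 • act (-p.1, p.2) F

lemma antipode_isUnit (y : translates) : IsUnit (aeval (-tau) (y : ℂ[X])) := by
  refine isUnit_of_translates (RingHomClass.toRingHom (aeval _)) (fun k => ?_) y
  have h := (IsLocalization.map_units K (⟨_, X_add_mem (-k)⟩ : translates)).neg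
  convert h using 1
  simp [tau]
  ring

/-- The antipodal homomorphism `S : K → K`, `τ ↦ -τ`. -/
def antipodeK : K →ₐ[ℂ] K :=
  IsLocalization.liftAlgHom (M := translates) (f := aeval (-tau)) antipode_isUnit

/-! ### Principal parts and the trace -/

lemma laurent_ofPoly (m : ℤ) (f : ℂ[X]) :
    laurent m (ofPoly f) =
      HahnSeries.ofPowerSeries ℤ ℂ ((taylor (m : ℂ) f : ℂ[X]) : PowerSeries ℂ) := by
  rw [← laurentPoly_eq]
  exact IsLocalization.lift_eq _ _

lemma laurent_coeff_neg (m : ℤ) (F : K) (f g : ℂ[X]) (hg : g ≠ 0) (hF : ofPoly g * F = ofPoly f)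
    (l : ℕ) (hl : (laurent m F).coeff (-(l + 1 : ℤ)) ≠ 0) : l < g.rootMultiplicity (m : ℂ) := by
  by_contra hlt
  apply hl
  set k := g.rootMultiplicity (m : ℂ) with hk
  obtain ⟨q, hq, hq0⟩ := exists_eq_pow_rootMultiplicity_mul_and_not_dvd g hg (m : ℂ)
  rw [← hk] at hq
  rw [dvd_iff_isRoot, IsRoot, ← taylor_coeff_zero] at hq0
  have hu : IsUnit ((taylor (m : ℂ) q : ℂ[X]) : PowerSeries ℂ) := by
    rw [PowerSeries.isUnit_iff_constantCoeff, isUnit_iff_ne_zero]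
    simpa using hq0
  obtain ⟨u, hu⟩ := hu
  have h1 := congrArg (laurent m) hF
  rw [map_mul, laurent_ofPoly, laurent_ofPoly, hq, taylor_mul, taylor_pow] at h1
  have h2 : taylor (m : ℂ) (X - C (m : ℂ)) = X := by
    rw [map_sub, taylor_X, taylor_C, add_sub_cancel_right]
  rw [h2, Polynomial.coe_mul, Polynomial.coe_pow, Polynomial.coe_X, ← hu, map_mul, map_pow,
    HahnSeries.ofPowerSeries_X, HahnSeries.single_pow, one_pow, nsmul_eq_mul, mul_one] at h1
  have h3 : HahnSeries.single (k : ℤ) (1 : ℂ) * laurent m F =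
      HahnSeries.ofPowerSeries ℤ ℂ
        ((u⁻¹ : (PowerSeries ℂ)ˣ) * ((taylor (m : ℂ) f : ℂ[X]) : PowerSeries ℂ)) := by
    have h5 : HahnSeries.ofPowerSeries ℤ ℂ ((u⁻¹ : (PowerSeries ℂ)ˣ) : PowerSeries ℂ) *
        HahnSeries.ofPowerSeries ℤ ℂ (u : PowerSeries ℂ) = 1 := by
      rw [← RingHom.map_mul, Units.inv_mul, RingHom.map_one]
    rw [map_mul, ← h1]
    linear_combination (-(HahnSeries.single (k : ℤ) (1 : ℂ) * laurent m F)) * h5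
  have h4 := congrArg (fun s : LaurentSeries ℂ => s.coeff (-(l + 1 : ℤ) + k)) h3
  have h6 : (HahnSeries.single (k : ℤ) (1 : ℂ) * laurent m F).coeff (-(l + 1 : ℤ) + k) =
      (laurent m F).coeff (-(l + 1 : ℤ)) := by
    rw [HahnSeries.coeff_single_mul_add, one_mul]
  rw [← h6]
  refine h4.trans ?_
  simp only [PowerSeries.coeff_coe]
  rw [if_pos (by omega)]

lemma translates_ne_zero (y : translates) : (y : ℂ[X]) ≠ 0 := by
  intro h
  have := laurent_isUnit 0 y
  rw [h, map_zero] at this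
  exact not_isUnit_zero this

lemma exists_fraction (F : K) : ∃ f g : ℂ[X], g ≠ 0 ∧ ofPoly g * F = ofPoly f := by
  obtain ⟨⟨f, g⟩, h⟩ := IsLocalization.surj translates F
  exact ⟨f, g, translates_ne_zero g, by rw [mul_comm]; exact h⟩

lemma finite_support_principalPart (F : K) :
    (Function.support fun p : Idx => (laurent p.1 F).coeff (-(p.2 + 1 : ℤ))).Finite := by
  obtain ⟨f, g, hg, hF⟩ := exists_fraction F
  have hfin : {m : ℤ | (m : ℂ) ∈ g.roots.toFinset}.Finite :=
    Set.Finite.preimage (Int.cast_injective.injOn) (Finset.finite_toSet g.roots.toFinset)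
  refine (hfin.prod (Set.finite_lt_nat g.natDegree)).subset ?_
  rintro ⟨m, l⟩ hp
  have h := laurent_coeff_neg m F f g hg hF l hp
  have hroot : g.IsRoot (m : ℂ) := (rootMultiplicity_pos hg).1 (by omega)
  refine ⟨by simpa [hg] using hroot, ?_⟩
  have : g.rootMultiplicity (m : ℂ) ≤ g.natDegree := by
    rw [← count_roots]
    exact (Multiset.count_le_card _ _).trans (card_roots' g)
  exact lt_of_lt_of_le h this

/-- The coordinates of the singular part of `F ∈ K` in the basis `1 / (τ - m) ^ (l + 1)` of
`K_Sing`, i.e. the coefficients of the principal parts of the rational function `F`. -/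
def principalPart : K →ₗ[ℂ] (Idx →₀ ℂ) where
  toFun F := Finsupp.ofSupportFinite (fun p => (laurent p.1 F).coeff (-(p.2 + 1 : ℤ)))
    (finite_support_principalPart F)
  map_add' F G := by ext p; simp [Finsupp.ofSupportFinite_coe]
  map_smul' c F := by
    ext p
    have h : laurent p.1 (c • F) = HahnSeries.C c * laurent p.1 F := by
      have hc : c • F = ofPoly (C c) * F := by
        rw [show ofPoly (C c) = algebraMap ℂ K c from (ofPoly.commutes c), Algebra.smul_def]
      rw [hc, map_mul, laurent_ofPoly, taylor_C, Polynomial.coe_C, HahnSeries.ofPowerSeries_C]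
    simp [Finsupp.ofSupportFinite_coe, h]

/-- The trace `Tr : K → ℂ`, i.e. the counit of `Ĥ` applied to the singular part; the counit of
`T ^ m ∂ ^ (l)` is `1` if `l = 0` and `0` otherwise, so this is the sum of the residues. -/
def trace : K →ₗ[ℂ] ℂ :=
  Finsupp.linearCombination ℂ (fun p : Idx => if p.2 = 0 then (1 : ℂ) else 0) ∘ₗ principalPart

lemma ofPoly_mul_polar (p : Idx) : ofPoly ((X - C (p.1 : ℂ)) ^ (p.2 + 1)) * polar p = 1 := by
  have h := IsLocalization.mk'_spec' K (1 : ℂ[X])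
    (⟨(X - C (p.1 : ℂ)) ^ (p.2 + 1), X_sub_pow_mem p.1 (p.2 + 1)⟩ : translates)
  rw [map_one] at h
  exact h

lemma trace_polar_mul (p : Idx) (G : ℂ[X]) :
    trace (polar p * ofPoly G) = (taylor (p.1 : ℂ) G).coeff p.2 := by
  obtain ⟨m, l⟩ := p
  have hF : ofPoly ((X - C (m : ℂ)) ^ (l + 1)) * (polar (m, l) * ofPoly G) = ofPoly G := by
    have h := ofPoly_mul_polar (m, l)
    simp only at h
    rw [← mul_assoc, h, one_mul]
  have hg : ((X - C (m : ℂ)) ^ (l + 1) : ℂ[X]) ≠ 0 := pow_ne_zero _ (X_sub_C_ne_zero _)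
  set F := polar (m, l) * ofPoly G with hFdef
  have hother : ∀ m' : ℤ, m' ≠ m → principalPart F (m', 0) = 0 := by
    intro m' hm
    by_contra h
    have h1 := laurent_coeff_neg m' F G _ hg hF 0 h
    rw [rootMultiplicity_eq_zero] at h1
    · omega
    · simp only [IsRoot, eval_pow, eval_sub, eval_X, eval_C]
      refine pow_ne_zero _ (sub_ne_zero.2 ?_)
      exact_mod_cast hm
  have hself : principalPart F (m, 0) = (taylor (m : ℂ) G).coeff l := by
    have h1 := congrArg (laurent m) hF
    have h2 : taylor (m : ℂ) (X - C (m : ℂ)) = X := by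
      rw [map_sub, taylor_X, taylor_C, add_sub_cancel_right]
    rw [map_mul, laurent_ofPoly, laurent_ofPoly, taylor_pow, h2, Polynomial.coe_pow,
      Polynomial.coe_X, map_pow, HahnSeries.ofPowerSeries_X, HahnSeries.single_pow, one_pow,
      nsmul_eq_mul, mul_one] at h1
    have h3 : (HahnSeries.single ((l + 1 : ℕ) : ℤ) (1 : ℂ) * laurent m F).coeff
        (-1 + ((l + 1 : ℕ) : ℤ)) = (laurent m F).coeff (-1) := by
      rw [HahnSeries.coeff_single_mul_add, one_mul]
    have h4 : principalPart F (m, 0) = (laurent m F).coeff (-1) := by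
      change (laurent m F).coeff (-(((0 : ℕ) : ℤ) + 1)) = _
      norm_num
    rw [h4, ← h3, h1, PowerSeries.coeff_coe, if_neg (by omega)]
    have h5 : (-1 + ((l + 1 : ℕ) : ℤ)).natAbs = l := by omega
    rw [h5, Polynomial.coeff_coe]
  rw [← hself, trace, LinearMap.comp_apply, Finsupp.linearCombination_apply,
    Finsupp.sum_eq_single (m, 0)]
  · simp
  · rintro ⟨m', l'⟩ h1 h2
    rcases Nat.eq_zero_or_pos l' with rfl | hl
    · exact absurd (hother m' (fun h => h2 (by rw [h]))) h1
    · simp [hl.ne']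
  · simp

/-! ### The Hopf algebra `Ĥ = ℂ[T, T⁻¹, ∂]` and its dual -/

/-- `Ĥ = H_T[∂]`, where `H_T = ℂ[T, T⁻¹]`; the variable of the polynomial ring is `∂`. -/
abbrev HHat : Type := (LaurentPolynomial ℂ)[X]

/-- The difference operators `Δ[m] = (T - 1) ^ m / m!` for `m ≥ 0` and
`Δ[-k] = (1 - T⁻¹) ^ k / k!` for `k > 0`. -/
def difference (m : ℤ) : LaurentPolynomial ℂ :=
  if 0 ≤ m then ((m.natAbs.factorial : ℂ)⁻¹) • (LaurentPolynomial.T 1 - 1) ^ m.natAbs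
  else ((m.natAbs.factorial : ℂ)⁻¹) • (1 - LaurentPolynomial.T (-1)) ^ m.natAbs

/-- The basis `e_{n,k} = Δ[n] ∂ ^ (k)` of `Ĥ`. -/
def diffBasis (p : Idx) : HHat :=
  C (((p.2.factorial : ℂ)⁻¹) • difference p.1) * X ^ p.2

/-- The basis `T ^ m ∂ ^ (l)` of `Ĥ`. -/
def transBasis (p : Idx) : HHat :=
  C (((p.2.factorial : ℂ)⁻¹) • LaurentPolynomial.T p.1) * X ^ p.2

/-- The antipode of `Ĥ`: `T ↦ T⁻¹`, `∂ ↦ -∂`. -/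
def antipodeH (h : HHat) : HHat :=
  (h.map (LaurentPolynomial.invert (R := ℂ)).toRingHom).comp (-X)

/-- The full linear dual `Ĥ*`. -/
abbrev HDual : Type := Module.Dual ℂ HHat

/-- The span in `Ĥ*` of the dual basis functionals `e*_{n,k}`, `e*_{n,k}(e_{m,l}) = δ_{nm} δ_{kl}`:
the functionals that are nonzero on only finitely many `e_{n,k}`. -/
def polHat : Submodule ℂ HDual where
  carrier := {φ | (Function.support fun p : Idx => φ (diffBasis p)).Finite}
  zero_mem' := by simp
  add_mem' := fun {φ ψ} hφ hψ => by
    refine (Set.Finite.union hφ hψ).subset ?_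
    intro p hp
    by_contra h
    simp only [Set.mem_union, Function.mem_support, not_or, not_not] at h
    exact hp (by simp [h.1, h.2])
  smul_mem' := fun c φ hφ => by
    refine Set.Finite.subset hφ ?_
    intro p hp h
    exact hp (by simp [h])

/-- `K̂`, the direct sum of the span of the `e*_{n,k}` and of `K_Sing`. -/
abbrev KHat : Type := polHat × KSing

/-! ### Distributions and fields -/

/-- `W`-valued distributions on `K`. -/
abbrev Dist (W : Type*) [AddCommGroup W] [Module ℂ W] : Type _ := K →ₗ[ℂ] W

section Kernel

variable {W : Type*} [AddCommGroup W] [Module ℂ W]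

/-- The distribution on polynomial sequences with rational kernel `R ∈ W ⊗ K_Sing`, namely
`G ↦ Tr (R G)`. An element `R` is given by its coordinates: it is
`∑ R (m, l) ⊗ 1 / (τ - m) ^ (l + 1)`. -/
def rationalDist : (Idx →₀ W) →ₗ[ℂ] (ℂ[X] →ₗ[ℂ] W) :=
  Finsupp.lsum ℂ fun p : Idx =>
    LinearMap.smulRightₗ (trace ∘ₗ LinearMap.mulLeft ℂ (polar p) ∘ₗ ofPoly.toLinearMap)

lemma rationalDist_apply (R : Idx →₀ W) (G : ℂ[X]) :
    rationalDist R G = R.sum fun p w => trace (polar p * ofPoly G) • w := by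
  simp [rationalDist, Finsupp.sum, LinearMap.sum_apply]

lemma taylor_coeff_pow_mul (m : ℂ) (k j : ℕ) (A : ℂ[X]) (hjk : j < k) :
    (taylor m ((X - C m) ^ k * A)).coeff j = 0 := by
  rw [taylor_mul, taylor_pow, map_sub, taylor_X, taylor_C, add_sub_cancel_right,
    coeff_X_pow_mul', if_neg (by omega)]

lemma taylor_coeff_pow_mul_self (m : ℂ) (k : ℕ) (A : ℂ[X]) :
    (taylor m ((X - C m) ^ k * A)).coeff k = A.eval m := by
  rw [taylor_mul, taylor_pow, map_sub, taylor_X, taylor_C, add_sub_cancel_right,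
    coeff_X_pow_mul', if_pos le_rfl, Nat.sub_self, taylor_coeff_zero]

lemma exists_max_order (s : Finset Idx) (m : ℤ) (l' : ℕ) (h : (m, l') ∈ s) :
    ∃ l, (m, l) ∈ s ∧ ∀ j, (m, j) ∈ s → j ≤ l := by
  obtain ⟨p, hp, hmax⟩ := (s.filter fun p => p.1 = m).exists_max_image (fun p => p.2)
    ⟨(m, l'), Finset.mem_filter.2 ⟨h, rfl⟩⟩
  obtain ⟨hp1, hp2⟩ := Finset.mem_filter.1 hp
  refine ⟨p.2, ?_, fun j hj => hmax (m, j) (Finset.mem_filter.2 ⟨hj, rfl⟩)⟩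
  rw [← hp2]
  exact hp1

lemma exists_separating (s : Finset Idx) (m : ℤ) :
    ∃ Q : ℂ[X], Q.eval (m : ℂ) ≠ 0 ∧ ∀ p ∈ s, p.1 ≠ m → ∀ A : ℂ[X],
      (taylor (p.1 : ℂ) (A * Q)).coeff p.2 = 0 := by
  refine ⟨∏ q ∈ s.filter fun q => q.1 ≠ m, (X - C (q.1 : ℂ)) ^ (q.2 + 1), ?_, ?_⟩
  · rw [eval_prod, Finset.prod_ne_zero_iff]
    intro q hq
    rw [eval_pow, eval_sub, eval_X, eval_C]
    refine pow_ne_zero _ (sub_ne_zero.2 ?_)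
    exact_mod_cast (Finset.mem_filter.1 hq).2.symm
  · intro p hp hpm A
    rw [← Finset.mul_prod_erase _ _ (Finset.mem_filter.2 ⟨hp, hpm⟩), mul_left_comm]
    exact taylor_coeff_pow_mul _ _ _ _ (Nat.lt_succ_self _)

lemma rationalDist_injective : Function.Injective (rationalDist (W := W)) := by
  rw [injective_iff_map_eq_zero]
  intro R hR
  by_contra hne
  obtain ⟨⟨m, l'⟩, hml⟩ := Finsupp.support_nonempty_iff.2 hne
  obtain ⟨l, hl, hmax⟩ := exists_max_order R.support m l' hml
  obtain ⟨Q, hQ0, hQ⟩ := exists_separating R.support m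
  have h := LinearMap.congr_fun hR ((X - C (m : ℂ)) ^ l * Q)
  rw [rationalDist_apply, Finsupp.sum, Finset.sum_eq_single (m, l), trace_polar_mul,
    taylor_coeff_pow_mul_self, LinearMap.zero_apply, smul_eq_zero] at h
  · rcases h with h | h
    · exact hQ0 h
    · exact Finsupp.mem_support_iff.1 hl h
  · rintro ⟨m', j⟩ hp hpne
    rw [trace_polar_mul]
    by_cases hm : m' = m
    · subst hm
      have hj : j < l := lt_of_le_of_ne (hmax j hp) (fun e => hpne (by rw [e]))
      rw [taylor_coeff_pow_mul _ l j Q hj, zero_smul]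
    · rw [hQ (m', j) hp hm, zero_smul]
  · intro h1
    exact absurd hl h1

end Kernel

section Fields

variable {V : Type*} [AddCommGroup V] [Module ℂ V]

/-- An `End(V)`-valued distribution `f` is a field on `V` if for every `v ∈ V` the singular part
of `f v` (its restriction to polynomial sequences) has a rational kernel in `V ⊗ K_Sing`. -/
def IsField (f : Dist (Module.End ℂ V)) : Prop :=
  ∀ v : V, ∃ R : Idx →₀ V, ∀ G : ℂ[X], f (ofPoly G) v = rationalDist R G

/-- The kernel of the singular part of a field `f`: the linear map that sends `v` to the unique
`R ∈ V ⊗ K_Sing` (in coordinates) with `f(G) v = Tr (R G)` for all polynomial sequences `G`. -/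
def singKernel (f : Dist (Module.End ℂ V)) (hf : IsField f) : V →ₗ[ℂ] (Idx →₀ V) :=
  (LinearEquiv.ofInjective rationalDist rationalDist_injective).symm.toLinearMap ∘ₗ
    LinearMap.codRestrict (LinearMap.range rationalDist) (f ∘ₗ ofPoly.toLinearMap).flip
      (fun v => by
        obtain ⟨R, hR⟩ := hf v
        exact ⟨R, LinearMap.ext fun G => (hR G).symm⟩)

lemma rationalDist_singKernel (f : Dist (Module.End ℂ V)) (hf : IsField f) (v : V) (G : ℂ[X]) :
    rationalDist (singKernel f hf v) G = f (ofPoly G) v := by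
  have h := (LinearEquiv.ofInjective rationalDist rationalDist_injective).apply_symm_apply
    (LinearMap.codRestrict (LinearMap.range rationalDist) (f ∘ₗ ofPoly.toLinearMap).flip
      (fun v => by
        obtain ⟨R, hR⟩ := hf v
        exact ⟨R, LinearMap.ext fun G => (hR G).symm⟩) v)
  exact LinearMap.congr_fun (congrArg Subtype.val h) G

/-- For a field `f` and operators `E p`, the operator `v ↦ ∑ E p (R p)`, where `R` is the kernel of
the singular part of `f v`. -/
def contract (f : Dist (Module.End ℂ V)) (hf : IsField f) :
    (Idx → Module.End ℂ V) →ₗ[ℂ] Module.End ℂ V :=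
  LinearMap.lcomp ℂ V (singKernel f hf) ∘ₗ (Finsupp.lsum ℂ).toLinearMap

lemma contract_apply (f : Dist (Module.End ℂ V)) (hf : IsField f) (E : Idx → Module.End ℂ V)
    (v : V) : contract f hf E v = (singKernel f hf v).sum fun p w => E p w := by
  simp [contract]

/-- The value `f(φ)` of a field `f` at `φ ∈ Ĥ*`, namely `f(φ) v = Tr (φ . R)` with `R` the kernel of
the singular part of `f v`. -/
def evalHat (f : Dist (Module.End ℂ V)) (hf : IsField f) (φ : HDual) : Module.End ℂ V :=
  contract f hf fun p => φ (transBasis p) • LinearMap.id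

/-- The product `A(τ) f(τ)` of a holomorphic distribution `A` and a field `f`. Here `A` is an
`End(V)`-valued distribution on `K_Sing ≅ Ĥ`, given by its values
`A (m, l) = A(1 / (τ - m) ^ (l + 1))`; equivalently its expansion at `τ = m` is
`∑ A (m, l) (τ - m) ^ l`. The first term is `A f_Hol`, the product of the expansions, which vanishes
on polynomial sequences. The second term is `A f_Sing`: if `R` is the kernel of the singular part of
`f v`, then `(A f_Sing)(G) v = A(R G)`, where `A` vanishes on polynomial sequences. -/
def holMul (A : Idx → Module.End ℂ V) (f : Dist (Module.End ℂ V)) (hf : IsField f) :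
    Dist (Module.End ℂ V) :=
  Finsupp.linearCombination ℂ (fun q : Idx =>
      ∑ ij ∈ Finset.HasAntidiagonal.antidiagonal q.2, A (q.1, ij.1) * f (polar (q.1, ij.2))) ∘ₗ principalPart +
    contract f hf ∘ₗ LinearMap.pi fun p : Idx =>
      Finsupp.linearCombination ℂ A ∘ₗ principalPart ∘ₗ LinearMap.mulLeft ℂ (polar p)

/-- The `F`-th normal ordered product of the fields `f` and `g` for `F ∈ K`,
`Tr_{τ₁} (f(τ₁) g(τ₂) R^S(τ₂)(F(τ₁)) - g(τ₂) f(τ₁) L^S(τ₁)(F(τ₂)))`,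
where `R^S(F) = ∑ S(h_p) F ⊗ h_p*` and `L^S(F) = ∑ h_p* ⊗ S(h_p F)` for the basis
`h_p = T ^ m ∂ ^ (l)`, `p = (m, l)`, of `Ĥ` and the dual functionals `h_p*`. -/
def nopK (f g : Dist (Module.End ℂ V)) (hf : IsField f) (hg : IsField g) (F : K) :
    Dist (Module.End ℂ V) :=
  holMul (fun p => f (actS p F)) g hg -
    contract f hf ∘ₗ LinearMap.pi fun p : Idx =>
      g ∘ₗ LinearMap.mulLeft ℂ (antipodeK (act p F))

/-- The `φ`-th normal ordered product of the fields `f` and `g` for `φ ∈ Ĥ*`, given by the same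
formula as for elements of `K`, with `Ĥ` acting on `Ĥ*` by `(h . φ)(h') = φ(h h')` and with
`(S φ)(h) = φ(S h)`. -/
def nopHat (f g : Dist (Module.End ℂ V)) (hf : IsField f) (hg : IsField g) (φ : HDual) :
    Dist (Module.End ℂ V) :=
  holMul (fun p => evalHat f hf (φ ∘ₗ LinearMap.mulLeft ℂ (antipodeH (transBasis p)))) g hg -
    contract f hf ∘ₗ LinearMap.pi fun p : Idx =>
      holMul (fun q => φ (transBasis p * antipodeH (transBasis q)) • LinearMap.id) g hg

/-- The `F`-th normal ordered product `f(τ)_{F} g(τ)` for `F ∈ K̂`. -/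
def normalOrderedProduct (f g : Dist (Module.End ℂ V)) (hf : IsField f) (hg : IsField g)
    (F : KHat) : Dist (Module.End ℂ V) :=
  nopHat f g hf hg (F.1 : HDual) + nopK f g hf hg (F.2 : K)

/-- The commutator distribution on `K ⊗ K`, with value `f(F) g(G) - g(G) f(F)` at `F ⊗ G`. -/
def commutator (f g : Dist (Module.End ℂ V)) : K ⊗[ℂ] K →ₗ[ℂ] Module.End ℂ V :=
  TensorProduct.lift
    ((LinearMap.mul ℂ (Module.End ℂ V)).compl₁₂ f g -
      ((LinearMap.mul ℂ (Module.End ℂ V)).compl₁₂ g f).flip)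

/-- The twisted coproduct `P(τ₁ - τ₂)` of a polynomial sequence `P(τ)`. -/
def twistedCoproduct : ℂ[X] →ₐ[ℂ] K ⊗[ℂ] K :=
  aeval (tau ⊗ₜ[ℂ] (1 : K) - (1 : K) ⊗ₜ[ℂ] tau)

/-- Mutual rationality: the commutator distribution is killed by multiplication by `P(τ₁ - τ₂)`
for some nonzero polynomial sequence `P`. -/
def MutuallyRational (f g : Dist (Module.End ℂ V)) : Prop :=
  ∃ P : ℂ[X], P ≠ 0 ∧ ∀ z : K ⊗[ℂ] K, commutator f g (twistedCoproduct P * z) = 0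

end Fields

end

end HTVertex

namespace HTVertex

open Polynomial TensorProduct

noncomputable section

/-! A field is a continuous distribution: for fixed G ∈ K and v, the vector f(tG)v vanishes once the
polynomial t vanishes to order n at all integers m with |m| ≤ n, for n large
(`field_eventually_eq_zero`). Conversely, if for each v the distribution kills some `boxIdeal n`,
then it is a field (`isField_of_boxIdeal`); this yields the first half of the theorem.

Continuity also turns the infinite sums in the normal ordered product N = a_{F}b into finite ones,
with Hermite interpolation polynomials in place of the dual functionals. For given G and w and all
large n, N(G)w = (a(τ₁)b(τ₂)R_n − b(τ₂)a(τ₁)L_n)(1 ⊗ G)w, where R_n and L_n in K ⊗ K are truncated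
expansions of F(τ₁ − τ₂) in τ₂ and in τ₁. If F = r/p, then p(τ₁ − τ₂)R_n and p(τ₁ − τ₂)L_n both tend
to r(τ₁ − τ₂) (`isRegularized_nopK`). For φ ∈ Ĥ* one polynomial B_n with Taylor coefficients
φ(h_{m,l}) on the box gives R_n = L_n = B_n(τ₁ − τ₂), so p = 1 works (`isRegularized_nopHat`).
`IsRegularized` records what both cases share.

The rest is Dong's argument in three variables (`IsRegularized.mutuallyRational`). The commutator of
N(τ₂) with c(τ₃) is the limit of (abc − cab)R_n − (bac − cba)L_n. Since τ₂ − τ₃ = (τ₁ − τ₃) − (τ₁ −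
τ₂), some nonzero Q has Q(τ₂ − τ₃) in the ideal generated by (p·P_ab)(τ₁ − τ₂) and P_ac(τ₁ − τ₃)
(`exists_aeval_sub_mem_span`). On the first generator p replaces R_n and L_n by a common limit and
P_ab exchanges a and b, so the two differences cancel. On the second, P_ac and an additional factor
P_bc(τ₂ − τ₃) move c past both a and b, so each difference vanishes. -/

/-- The Taylor coefficient of a polynomial at the integer `p.1` of order `p.2`. -/
def taylorCoeff (p : Idx) : ℂ[X] →ₗ[ℂ] ℂ :=
  lcoeff ℂ p.2 ∘ₗ taylor (p.1 : ℂ)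

lemma taylorCoeff_apply (p : Idx) (G : ℂ[X]) :
    taylorCoeff p G = (taylor (p.1 : ℂ) G).coeff p.2 := rfl

lemma taylorCoeff_mul (m : ℤ) (l : ℕ) (f g : ℂ[X]) :
    taylorCoeff (m, l) (f * g) =
      ∑ ij ∈ Finset.HasAntidiagonal.antidiagonal l, taylorCoeff (m, ij.1) f * taylorCoeff (m, ij.2) g := by
  simp [taylorCoeff_apply, taylor_mul, coeff_mul]

/-! ### Principal parts and traces of polynomials and polar elements -/

lemma principalPart_apply (F : K) (p : Idx) :
    principalPart F p = (laurent p.1 F).coeff (-(p.2 + 1 : ℤ)) := rfl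

lemma principalPart_ofPoly (f : ℂ[X]) : principalPart (ofPoly f) = 0 := by
  ext p
  rw [principalPart_apply, laurent_ofPoly, PowerSeries.coeff_coe, if_pos (by omega)]
  rfl

lemma trace_ofPoly (f : ℂ[X]) : trace (ofPoly f) = 0 := by
  rw [trace, LinearMap.comp_apply, principalPart_ofPoly, map_zero]

lemma taylor_X_sub_C_self (m : ℂ) : taylor m (X - C m) = X := by
  rw [map_sub, taylor_X, taylor_C, add_sub_cancel_right]

lemma principalPart_polar (p : Idx) : principalPart (polar p) = Finsupp.single p 1 := by
  obtain ⟨m, l⟩ := p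
  have hF : ofPoly ((X - C (m : ℂ)) ^ (l + 1)) * polar (m, l) = ofPoly 1 := by
    rw [map_one]; exact ofPoly_mul_polar (m, l)
  have hg : ((X - C (m : ℂ)) ^ (l + 1) : ℂ[X]) ≠ 0 := pow_ne_zero _ (X_sub_C_ne_zero _)
  ext ⟨m', l'⟩
  by_cases hm : m' = m
  · subst hm
    have h1 := congrArg (laurent m') hF
    rw [map_mul, laurent_ofPoly, laurent_ofPoly, taylor_pow, taylor_X_sub_C_self, taylor_one, map_one,
      Polynomial.coe_pow, Polynomial.coe_X, map_pow, HahnSeries.ofPowerSeries_X,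
      HahnSeries.single_pow, one_pow, nsmul_eq_mul, mul_one] at h1
    -- The factor t^(l+1) shifts exponents by l + 1, so the coefficient is that of t^(l−l') in 1,
    -- nonzero exactly for l' = l.
    have h2 := congrArg (fun s : LaurentSeries ℂ => s.coeff (-(l' + 1 : ℤ) + (l + 1 : ℕ))) h1
    simp only [HahnSeries.coeff_single_mul_add, one_mul] at h2
    rw [principalPart_apply, h2, Polynomial.coe_one, map_one, HahnSeries.coeff_one,
      Finsupp.single_apply]
    simp only [Prod.mk.injEq, true_and]
    congr 1
    apply propext
    push_cast
    omega
  · rw [Finsupp.single_eq_of_ne (by simp [hm])]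
    by_contra h
    have h1 := laurent_coeff_neg m' _ _ _ hg hF l' h
    rw [rootMultiplicity_eq_zero] at h1
    · omega
    · simp only [IsRoot, eval_pow, eval_sub, eval_X, eval_C]
      refine pow_ne_zero _ (sub_ne_zero.2 ?_)
      exact_mod_cast hm

lemma trace_polar (p : Idx) : trace (polar p) = if p.2 = 0 then 1 else 0 := by
  rw [trace, LinearMap.comp_apply, principalPart_polar, Finsupp.linearCombination_single, one_smul]

/-! ### Partial fractions -/

lemma ofPoly_X : ofPoly X = tau := rfl

lemma ofPoly_C (c : ℂ) : ofPoly (C c) = algebraMap ℂ K c := ofPoly.commutes c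

lemma polar_zero_mul (m : ℤ) : (tau - algebraMap ℂ K m) * polar (m, 0) = 1 := by
  have := ofPoly_mul_polar (m, 0)
  simpa only [zero_add, pow_one, map_sub, ofPoly_X, ofPoly_C] using this

lemma polar_eq_pow (m : ℤ) (l : ℕ) : polar (m, l) = polar (m, 0) ^ (l + 1) := by
  have h1 := ofPoly_mul_polar (m, l)
  simp only [map_pow, map_sub, ofPoly_X, ofPoly_C] at h1
  have h2 : (tau - algebraMap ℂ K m) ^ (l + 1) * polar (m, 0) ^ (l + 1) = 1 := by
    rw [← mul_pow, polar_zero_mul, one_pow]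
  calc polar (m, l) = polar (m, l) * ((tau - algebraMap ℂ K m) ^ (l + 1) *
      polar (m, 0) ^ (l + 1)) := by rw [h2, mul_one]
    _ = ((tau - algebraMap ℂ K m) ^ (l + 1) * polar (m, l)) * polar (m, 0) ^ (l + 1) := by ring
    _ = _ := by rw [h1, one_mul]

lemma polar_mul_polar_same (m : ℤ) (i j : ℕ) :
    polar (m, i) * polar (m, j) = polar (m, i + j + 1) := by
  rw [polar_eq_pow m i, polar_eq_pow m j, polar_eq_pow m (i + j + 1), ← pow_add]
  congr 1
  omega

lemma polar_mul_polar_zero {m m' : ℤ} (h : m ≠ m') :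
    polar (m, 0) * polar (m', 0) =
      ((m : ℂ) - m')⁻¹ • (polar (m, 0) - polar (m', 0)) := by
  have hc : ((m : ℂ) - m') ≠ 0 := sub_ne_zero.2 (by exact_mod_cast h)
  rw [eq_inv_smul_iff₀ hc, Algebra.smul_def, map_sub]
  linear_combination (polar (m, 0)) * polar_zero_mul m' - polar (m', 0) * polar_zero_mul m

lemma ofPoly_mul_polar_zero (m : ℤ) (t : ℂ[X]) :
    ∃ q : ℂ[X], ofPoly t * polar (m, 0) = t.eval (m : ℂ) • polar (m, 0) + ofPoly q := by
  obtain ⟨q, hq⟩ := X_sub_C_dvd_sub_C_eval (a := (m : ℂ)) (p := t)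
  refine ⟨q, ?_⟩
  have h1 : ofPoly t = ofPoly (C (t.eval (m : ℂ))) + ofPoly ((X - C (m : ℂ)) * q) := by
    rw [← map_add, ← hq]; congr 1; ring
  have h2 := polar_zero_mul m
  rw [h1, map_mul, map_sub, ofPoly_X, ofPoly_C, ofPoly_C, Algebra.smul_def]
  linear_combination (ofPoly q) * h2

/-- The sum of `K_Sing` and of the polynomial sequences. -/
def polarSum : Submodule ℂ K := KSing ⊔ LinearMap.range ofPoly.toLinearMap

lemma polar_mem_polarSum (p : Idx) : polar p ∈ polarSum :=
  Submodule.mem_sup_left (Submodule.subset_span ⟨p, rfl⟩)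

lemma ofPoly_mem_polarSum (f : ℂ[X]) : ofPoly f ∈ polarSum :=
  Submodule.mem_sup_right ⟨f, rfl⟩

lemma mul_polar_zero_mem (m : ℤ) {F : K} (hF : F ∈ polarSum) : F * polar (m, 0) ∈ polarSum := by
  have hle : polarSum ≤ polarSum.comap (LinearMap.mulRight ℂ (polar (m, 0))) := by
    refine sup_le (Submodule.span_le.2 ?_) ?_
    · rintro _ ⟨⟨m', l⟩, rfl⟩
      change polar (m', l) * polar (m, 0) ∈ polarSum
      by_cases h : m' = m
      · subst h
        rw [polar_mul_polar_same]
        exact polar_mem_polarSum _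
      · induction l with
        | zero =>
          rw [polar_mul_polar_zero h]
          exact Submodule.smul_mem _ _ (Submodule.sub_mem _ (polar_mem_polarSum _)
            (polar_mem_polarSum _))
        | succ l ih =>
          have h1 : polar (m', l + 1) * polar (m, 0) = ((m' : ℂ) - m)⁻¹ •
              (polar (m', l + 1) - polar (m', l) * polar (m, 0)) := by
            rw [polar_eq_pow m' (l + 1), polar_eq_pow m' l, pow_succ, mul_assoc,
              polar_mul_polar_zero h, mul_smul_comm, mul_sub]
          rw [h1]
          exact Submodule.smul_mem _ _ (Submodule.sub_mem _ (polar_mem_polarSum _) ih)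
    · rintro _ ⟨t, rfl⟩
      obtain ⟨q, hq⟩ := ofPoly_mul_polar_zero m t
      simp only [Submodule.mem_comap, LinearMap.mulRight_apply, AlgHom.toLinearMap_apply]
      rw [hq]
      exact Submodule.add_mem _ (Submodule.smul_mem _ _ (polar_mem_polarSum _))
        (ofPoly_mem_polarSum _)
  exact hle hF

/-- The sum is stable under multiplication by each 1/(τ − m), so the factors of a denominator can be
removed one at a time. -/
lemma polarSum_eq_top : polarSum = ⊤ := by
  rw [eq_top_iff]
  rintro F -
  obtain ⟨⟨f, y, hy⟩, h⟩ := IsLocalization.surj translates F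
  have hF : F * ofPoly y ∈ polarSum := by
    have : F * ofPoly y = ofPoly f := h
    rw [this]; exact ofPoly_mem_polarSum f
  clear h
  induction hy using Submonoid.closure_induction generalizing F with
  | mem y hy =>
    obtain ⟨k, rfl⟩ := hy
    have h1 := mul_polar_zero_mem (-k) hF
    have h2 := polar_zero_mul (-k)
    have h3 : F * ofPoly (X + C (k : ℂ)) * polar (-k, 0) = F := by
      have : ofPoly (X + C (k : ℂ)) = tau - algebraMap ℂ K ((-k : ℤ) : ℂ) := by
        rw [map_add, ofPoly_X, ofPoly_C]; simp
      rw [this, mul_assoc, h2, mul_one]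
    rwa [h3] at h1
  | one => simpa using hF
  | mul x y _ _ hx hy =>
    rw [map_mul, ← mul_assoc] at hF
    exact hx (hy hF)

lemma exists_partialFractions (F : K) :
    ∃ h : ℂ[X], F = Finsupp.linearCombination ℂ polar (principalPart F) + ofPoly h := by
  have hF : F ∈ polarSum := by rw [polarSum_eq_top]; trivial
  obtain ⟨s, hs, _, ⟨h, rfl⟩, rfl⟩ := Submodule.mem_sup.1 hF
  obtain ⟨c, rfl⟩ := (Finsupp.mem_span_range_iff_exists_finsupp).1 hs
  refine ⟨h, ?_⟩
  have h1 : principalPart (c.sum fun i a => a • polar i) = c := by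
    simp only [Finsupp.sum, map_sum, map_smul, principalPart_polar, Finsupp.smul_single,
      smul_eq_mul, mul_one]
    exact Finsupp.sum_single c
  have h2 : principalPart (ofPoly.toLinearMap h) = 0 := principalPart_ofPoly h
  rw [map_add, h1, h2, add_zero]
  rfl

/-- The product is O(τ⁻²) at infinity, so its residues sum to zero. Algebraically, the partial
fraction identity for two simple poles lowers the total order; the induction is on i + j. -/
lemma trace_polar_mul_polar (p q : Idx) : trace (polar p * polar q) = 0 := by
  obtain ⟨m, i⟩ := p
  obtain ⟨m', j⟩ := q
  by_cases h : m = m'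
  · subst h
    rw [polar_mul_polar_same, trace_polar, if_neg (by simp)]
  · have hij : ∀ n i j : ℕ, i + j = n → trace (polar (m, i) * polar (m', j)) = 0 := by
      intro n
      induction n using Nat.strong_induction_on with
      | _ n ih =>
        intro i j hn
        have h0 := polar_mul_polar_zero h
        rcases i with _ | i <;> rcases j with _ | j
        · rw [h0, map_smul, map_sub, trace_polar, trace_polar]; simp
        · have h1 : polar (m, 0) * polar (m', j + 1) = ((m : ℂ) - m')⁻¹ •
              (polar (m, 0) * polar (m', j) - polar (m', j + 1)) := by
            rw [polar_eq_pow m' (j + 1), polar_eq_pow m' j, pow_succ' _ (j + 1), ← mul_assoc, h0,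
              smul_mul_assoc, sub_mul]
          rw [h1, map_smul, map_sub, trace_polar, ih j (by omega) 0 j (by omega)]; simp
        · have h1 : polar (m, i + 1) * polar (m', 0) = ((m : ℂ) - m')⁻¹ •
              (polar (m, i + 1) - polar (m, i) * polar (m', 0)) := by
            rw [polar_eq_pow m (i + 1), polar_eq_pow m i, pow_succ, mul_assoc, h0,
              mul_smul_comm, mul_sub]
          rw [h1, map_smul, map_sub, trace_polar, ih i (by omega) i 0 (by omega)]; simp
        · have h1 : polar (m, i + 1) * polar (m', j + 1) = ((m : ℂ) - m')⁻¹ •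
              (polar (m, i + 1) * polar (m', j) - polar (m, i) * polar (m', j + 1)) := by
            rw [polar_eq_pow m (i + 1), polar_eq_pow m i, polar_eq_pow m' (j + 1),
              polar_eq_pow m' j]
            have : polar (m, 0) ^ (i + 1 + 1) * polar (m', 0) ^ (j + 1 + 1) =
              (polar (m, 0) * polar (m', 0)) * (polar (m, 0) ^ (i + 1) * polar (m', 0) ^ (j + 1)) :=
              by ring
            rw [this, h0, smul_mul_assoc]
            congr 1
            ring
          rw [h1, map_smul, map_sub, ih (i + 1 + j) (by omega) _ _ rfl,
            ih (i + (j + 1)) (by omega) _ _ rfl]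
          simp
    exact hij _ i j rfl

lemma trace_ofPoly_mul_polar (p : Idx) (t : ℂ[X]) :
    trace (ofPoly t * polar p) = taylorCoeff p t := by
  rw [mul_comm, trace_polar_mul]; rfl

lemma trace_ofPoly_mul (t : ℂ[X]) (F : K) :
    trace (ofPoly t * F) = Finsupp.linearCombination ℂ (fun q => taylorCoeff q t)
      (principalPart F) := by
  obtain ⟨h, hF⟩ := exists_partialFractions F
  conv_lhs => rw [hF, mul_add, ← map_mul, map_add, trace_ofPoly, add_zero,
    Finsupp.linearCombination_apply, Finsupp.sum, Finset.mul_sum, map_sum]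
  rw [Finsupp.linearCombination_apply, Finsupp.sum]
  refine Finset.sum_congr rfl fun q _ => ?_
  rw [mul_smul_comm, map_smul, trace_ofPoly_mul_polar]

/-- Only the Taylor polynomial of t at m of degree l contributes to the singular part. Writing t =
t(m) + (τ − m)q lowers the pole order by one, and the Taylor coefficients of q are those of t
shifted by one. -/
lemma exists_ofPoly_mul_polar (t : ℂ[X]) (m : ℤ) (l : ℕ) :
    ∃ h : ℂ[X], ofPoly t * polar (m, l) =
      ∑ ij ∈ Finset.HasAntidiagonal.antidiagonal l, taylorCoeff (m, ij.1) t • polar (m, ij.2) + ofPoly h := by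
  induction l generalizing t with
  | zero =>
    obtain ⟨q, hq⟩ := ofPoly_mul_polar_zero m t
    refine ⟨q, ?_⟩
    simpa [taylorCoeff_apply, taylor_coeff_zero] using hq
  | succ l ih =>
    obtain ⟨q, hq⟩ := X_sub_C_dvd_sub_C_eval (a := (m : ℂ)) (p := t)
    obtain ⟨h, hh⟩ := ih q
    refine ⟨h, ?_⟩
    have ht : t = C (t.eval (m : ℂ)) + (X - C (m : ℂ)) * q := by rw [← hq]; ring
    have h0 : taylorCoeff (m, 0) t = t.eval (m : ℂ) := by
      simp [taylorCoeff_apply, taylor_coeff_zero]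
    have hs : ∀ i : ℕ, taylorCoeff (m, i + 1) t = taylorCoeff (m, i) q := by
      intro i
      conv_lhs => rw [ht]
      simp only [taylorCoeff_apply, map_add, taylor_mul, taylor_X_sub_C_self, taylor_C,
        coeff_C_succ, coeff_X_mul, zero_add]
    rw [Finset.Nat.antidiagonal_succ, Finset.sum_cons, Finset.sum_map]
    simp only [Function.Embedding.prodMap, Function.Embedding.coeFn_mk, Prod.map,
      Nat.succ_eq_add_one, hs, h0, Function.Embedding.refl_apply]
    rw [add_assoc, ← hh]
    conv_lhs => rw [ht]
    rw [map_add, map_mul, map_sub, ofPoly_X, ofPoly_C, ofPoly_C, Algebra.smul_def,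
      polar_eq_pow m (l + 1), polar_eq_pow m l]
    linear_combination (ofPoly q * polar (m, 0) ^ (l + 1)) * polar_zero_mul m

lemma principalPart_ofPoly_mul_polar (t : ℂ[X]) (m : ℤ) (l : ℕ) :
    principalPart (ofPoly t * polar (m, l)) =
      ∑ ij ∈ Finset.HasAntidiagonal.antidiagonal l, Finsupp.single (m, ij.2) (taylorCoeff (m, ij.1) t) := by
  obtain ⟨h, hh⟩ := exists_ofPoly_mul_polar t m l
  rw [hh, map_add, principalPart_ofPoly, add_zero, map_sum]
  refine Finset.sum_congr rfl fun ij _ => ?_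
  rw [map_smul, principalPart_polar, Finsupp.smul_single, smul_eq_mul, mul_one]

lemma principalPart_ofPoly_mul (t : ℂ[X]) (F : K) :
    principalPart (ofPoly t * F) = (principalPart F).sum fun q c =>
      c • ∑ ij ∈ Finset.HasAntidiagonal.antidiagonal q.2, Finsupp.single (q.1, ij.2) (taylorCoeff (q.1, ij.1) t) := by
  obtain ⟨h, hF⟩ := exists_partialFractions F
  conv_lhs => rw [hF, mul_add, ← map_mul, map_add, principalPart_ofPoly, add_zero,
    Finsupp.linearCombination_apply, Finsupp.sum, Finset.mul_sum, map_sum]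
  refine Finset.sum_congr rfl fun q _ => ?_
  obtain ⟨m, l⟩ := q
  rw [mul_smul_comm, map_smul, principalPart_ofPoly_mul_polar]

/-! ### Boxes of indices and interpolation -/

/-- The box of the indices `(m, l)` with `|m| ≤ n` and `l < n`. -/
def box (n : ℕ) : Finset Idx := Finset.Icc (-(n : ℤ)) n ×ˢ Finset.range n

lemma mem_box {n : ℕ} {p : Idx} : p ∈ box n ↔ (-(n : ℤ) ≤ p.1 ∧ p.1 ≤ n) ∧ p.2 < n := by
  simp [box]

lemma box_lower {n : ℕ} {m : ℤ} {i l : ℕ} (hil : i ≤ l) (h : (m, l) ∈ box n) : (m, i) ∈ box n := by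
  rw [mem_box] at h ⊢
  exact ⟨h.1, lt_of_le_of_lt hil h.2⟩

lemma eventually_mem_box (p : Idx) : ∀ᶠ n in Filter.atTop, p ∈ box n := by
  filter_upwards [Filter.eventually_ge_atTop (p.1.natAbs + p.2 + 1)] with n hn
  rw [mem_box]
  omega

lemma eventually_subset_box (S : Finset Idx) : ∀ᶠ n in Filter.atTop, S ⊆ box n :=
  (Filter.eventually_all_finset S).2 fun p _ => eventually_mem_box p

/-- The polynomials whose Taylor coefficients vanish on the box. -/
def boxIdeal (n : ℕ) : Ideal ℂ[X] where
  carrier := {t | ∀ q ∈ box n, taylorCoeff q t = 0}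
  zero_mem' := fun q _ => map_zero _
  add_mem' := fun {s t} hs ht q hq => by rw [map_add, hs q hq, ht q hq, add_zero]
  smul_mem' := fun c t ht q hq => by
    obtain ⟨m, l⟩ := q
    rw [smul_eq_mul, taylorCoeff_mul]
    refine Finset.sum_eq_zero fun ij hij => ?_
    -- The box is closed under lowering the order, so the Leibniz rule never leaves it.
    rw [ht (m, ij.2) (box_lower (by have := Finset.HasAntidiagonal.mem_antidiagonal.1 hij; omega) hq), mul_zero]

/-- Hermite interpolation, obtained by duality: a linear relation among the Taylor functionals would
be a nonzero kernel with zero distribution, against `rationalDist_injective`. -/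
lemma exists_interpolation (S : Finset Idx) : ∃ t : Idx → ℂ[X],
    ∀ p ∈ S, ∀ q ∈ S, taylorCoeff q (t p) = if p = q then 1 else 0 := by
  set Φ : ℂ[X] →ₗ[ℂ] (S → ℂ) := LinearMap.pi fun q => taylorCoeff q.1 with hΦ
  have hsurj : LinearMap.range Φ = ⊤ := by
    by_contra hne
    obtain ⟨f, hf0, hf⟩ := Submodule.exists_le_ker_of_lt_top _ (lt_top_iff_ne_top.2 hne)
    apply hf0
    -- The coordinates of the functional f, which vanishes on the range of Φ, are read as the
    -- coordinates of a kernel.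
    set R : Idx →₀ ℂ := ∑ q : S, Finsupp.single q.1 (f (Pi.single q 1)) with hR
    have hR0 : R = 0 := by
      apply rationalDist_injective
      ext1 n
      ext1
      rw [map_zero]
      have h1 : f (Φ (monomial n 1)) = 0 := hf ⟨_, rfl⟩
      rw [LinearMap.pi_apply_eq_sum_univ f] at h1
      rw [LinearMap.comp_apply, hR, map_sum, LinearMap.sum_apply]
      refine Eq.trans (Finset.sum_congr rfl fun q _ => ?_) h1
      rw [rationalDist_apply, Finsupp.sum_single_index (by simp), trace_polar_mul]
      congr 2
      ext j
      simp [Pi.single_apply, eq_comm]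
    ext q
    have h2 := DFunLike.congr_fun hR0 q.1
    rw [hR, Finsupp.finsetSum_apply, Finset.sum_eq_single q] at h2
    · simpa using h2
    · intro q' _ hq'
      exact Finsupp.single_eq_of_ne (fun h => hq' (Subtype.ext h.symm))
    · simp
  have hex : ∀ p : S, ∃ t, Φ t = Pi.single p 1 := fun p => by
    rw [← LinearMap.mem_range, hsurj]; trivial
  choose t ht using hex
  refine ⟨fun p => if h : p ∈ S then t ⟨p, h⟩ else 0, fun p hp q hq => ?_⟩
  have h := congrFun (ht ⟨p, hp⟩) ⟨q, hq⟩
  simp only [hΦ, LinearMap.pi_apply, Pi.single_apply, Subtype.mk.injEq] at h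
  simp only [dif_pos hp, h, eq_comm]

/-- Polynomials dual to the Taylor coefficients on the box. -/
def interp (n : ℕ) : Idx → ℂ[X] := (exists_interpolation (box n)).choose

lemma taylorCoeff_interp {n : ℕ} {p q : Idx} (hp : p ∈ box n) (hq : q ∈ box n) :
    taylorCoeff q (interp n p) = if p = q then 1 else 0 :=
  (exists_interpolation (box n)).choose_spec p hp q hq

lemma sum_taylorCoeff_interp {n : ℕ} (c : Idx → ℂ) {q : Idx} (hq : q ∈ box n) :
    taylorCoeff q (∑ p ∈ box n, c p • interp n p) = c q := by
  rw [map_sum, Finset.sum_eq_single q]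
  · rw [map_smul, taylorCoeff_interp hq hq, if_pos rfl, smul_eq_mul, mul_one]
  · intro p hp hpq
    rw [map_smul, taylorCoeff_interp hp hq, if_neg hpq, smul_zero]
  · exact fun h => absurd hq h

lemma sub_interp_mem_boxIdeal (n : ℕ) (t : ℂ[X]) :
    t - ∑ p ∈ box n, taylorCoeff p t • interp n p ∈ boxIdeal n := fun q hq => by
  rw [map_sub, sum_taylorCoeff_interp (fun p => taylorCoeff p t) hq, sub_self]

variable {V : Type*} [AddCommGroup V] [Module ℂ V]

lemma principalPart_mul_eq_zero {n : ℕ} {t : ℂ[X]} (ht : t ∈ boxIdeal n) {F : K}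
    (hF : (principalPart F).support ⊆ box n) : principalPart (ofPoly t * F) = 0 := by
  rw [principalPart_ofPoly_mul]
  refine Finset.sum_eq_zero fun q hq => ?_
  beta_reduce
  rw [Finset.sum_eq_zero, smul_zero]
  intro ij hij
  rw [ht (q.1, ij.1) (box_lower (by have := Finset.HasAntidiagonal.mem_antidiagonal.1 hij; omega)
    (hF hq)), Finsupp.single_zero]

lemma trace_mul_eq_zero {n : ℕ} {t : ℂ[X]} (ht : t ∈ boxIdeal n) {F : K}
    (hF : (principalPart F).support ⊆ box n) : trace (ofPoly t * F) = 0 := by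
  rw [trace_ofPoly_mul, Finsupp.linearCombination_apply]
  refine Finset.sum_eq_zero fun q hq => ?_
  beta_reduce
  rw [ht q (hF hq), smul_zero]

/-! ### Continuity of fields -/

lemma field_apply_ofPoly (f : Dist (Module.End ℂ V)) (hf : IsField f) (v : V) (t : ℂ[X]) :
    f (ofPoly t) v = (singKernel f hf v).sum fun p w => taylorCoeff p t • w := by
  rw [← rationalDist_singKernel f hf, rationalDist_apply]
  simp only [trace_polar_mul]
  rfl

/-- Once the box contains the poles of G, the product tG is a polynomial. Its pairing with the
kernel of f at v involves only the traces of tG · `polar p` for finitely many p, and these vanish on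
a larger box. -/
lemma field_eventually_eq_zero (f : Dist (Module.End ℂ V)) (hf : IsField f) (G : K) (v : V) :
    ∀ᶠ n in Filter.atTop, ∀ t ∈ boxIdeal n, f (ofPoly t * G) v = 0 := by
  filter_upwards [eventually_subset_box (principalPart G).support,
    (Filter.eventually_all_finset (singKernel f hf v).support).2 fun p _ =>
      eventually_subset_box (principalPart (G * polar p)).support] with n h1 h2 t ht
  obtain ⟨h, hh⟩ := exists_partialFractions (ofPoly t * G)
  rw [principalPart_mul_eq_zero ht h1, map_zero, zero_add] at hh
  rw [hh, field_apply_ofPoly f hf]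
  refine Finset.sum_eq_zero fun p hp => ?_
  beta_reduce
  rw [← trace_ofPoly_mul_polar, ← hh, mul_assoc, trace_mul_eq_zero ht (h2 p hp), zero_smul]

lemma poly_apply_eq_sum {n : ℕ} {W : Type*} [AddCommGroup W] [Module ℂ W] (f : ℂ[X] →ₗ[ℂ] W)
    (hf : ∀ t ∈ boxIdeal n, f t = 0) (t : ℂ[X]) :
    f t = ∑ q ∈ box n, taylorCoeff q t • f (interp n q) := by
  have h := hf _ (sub_interp_mem_boxIdeal n t)
  rw [map_sub, sub_eq_zero] at h
  simpa using h

lemma rationalDist_sum_single {n : ℕ} {W : Type*} [AddCommGroup W] [Module ℂ W] (f : ℂ[X] →ₗ[ℂ] W)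
    (hf : ∀ t ∈ boxIdeal n, f t = 0) :
    rationalDist (∑ q ∈ box n, Finsupp.single q (f (interp n q))) = f := by
  ext1 j
  ext1
  simp only [LinearMap.comp_apply]
  rw [poly_apply_eq_sum f hf, map_sum, LinearMap.sum_apply]
  refine Finset.sum_congr rfl fun q _ => ?_
  rw [rationalDist_apply, Finsupp.sum_single_index (by simp), trace_polar_mul]
  rfl

lemma isField_of_boxIdeal (f : Dist (Module.End ℂ V))
    (h : ∀ v, ∃ n, ∀ t ∈ boxIdeal n, f (ofPoly t) v = 0) : IsField f := by
  intro v
  obtain ⟨n, hn⟩ := h v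
  refine ⟨_, fun G => (LinearMap.congr_fun (rationalDist_sum_single
    ((f ∘ₗ ofPoly.toLinearMap).flip v) hn) G).symm⟩

/-- By uniqueness of the kernel, its coordinates are the values of f at the interpolation
polynomials. The bound on n does not depend on E. -/
lemma contract_eventually (f : Dist (Module.End ℂ V)) (hf : IsField f) (v : V) :
    ∀ᶠ n in Filter.atTop, ∀ E : Idx → Module.End ℂ V,
      contract f hf E v = ∑ q ∈ box n, E q (f (ofPoly (interp n q)) v) := by
  filter_upwards [field_eventually_eq_zero f hf 1 v] with n hn E
  simp only [mul_one] at hn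
  have h : singKernel f hf v = ∑ q ∈ box n, Finsupp.single q (f (ofPoly (interp n q)) v) := by
    apply rationalDist_injective
    refine Eq.trans ?_ (rationalDist_sum_single ((f ∘ₗ ofPoly.toLinearMap).flip v) hn).symm
    exact LinearMap.ext fun G => rationalDist_singKernel f hf v G
  rw [contract_apply, h, ← Finsupp.sum_finsetSum_index (by simp) (by simp)]
  refine Finset.sum_congr rfl fun q _ => ?_
  rw [Finsupp.sum_single_index (by simp)]

/-! ### Products of holomorphic distributions and fields -/

lemma holMul_apply (A : Idx → Module.End ℂ V) (g : Dist (Module.End ℂ V)) (hg : IsField g) (G : K)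
    (w : V) : holMul A g hg G w =
      ((principalPart G).sum fun q c => c • ∑ ij ∈ Finset.HasAntidiagonal.antidiagonal q.2,
        A (q.1, ij.1) (g (polar (q.1, ij.2)) w)) +
      (singKernel g hg w).sum fun p u => (principalPart (polar p * G)).sum fun q c => c • A q u := by
  rw [holMul, LinearMap.add_apply, LinearMap.add_apply]
  congr 1
  · simp [Finsupp.linearCombination_apply, Finsupp.sum, LinearMap.sum_apply]
  · rw [LinearMap.comp_apply, contract_apply]
    simp [Finsupp.linearCombination_apply, Finsupp.sum, LinearMap.sum_apply]

lemma holMul_congr_eventually (g : Dist (Module.End ℂ V)) (hg : IsField g) (G : K) (w : V) :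
    ∀ᶠ n in Filter.atTop, ∀ A B : Idx → Module.End ℂ V, (∀ q ∈ box n, A q = B q) →
      holMul A g hg G w = holMul B g hg G w := by
  filter_upwards [eventually_subset_box (principalPart G).support,
    (Filter.eventually_all_finset (singKernel g hg w).support).2 fun p _ =>
      eventually_subset_box (principalPart (polar p * G)).support] with n h1 h2 A B hAB
  rw [holMul_apply, holMul_apply]
  congr 1
  · refine Finset.sum_congr rfl fun q hq => ?_
    beta_reduce
    congr 1
    refine Finset.sum_congr rfl fun ij hij => ?_
    rw [hAB _ (box_lower (by have := Finset.HasAntidiagonal.mem_antidiagonal.1 hij; omega) (h1 hq))]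
  · refine Finset.sum_congr rfl fun p hp => Finset.sum_congr rfl fun q hq => ?_
    beta_reduce
    rw [hAB q (h2 p hp hq)]

lemma holMul_sum {ι : Type*} (S : Finset ι) (A : ι → Idx → Module.End ℂ V)
    (g : Dist (Module.End ℂ V)) (hg : IsField g) (G : K) (w : V) :
    holMul (fun q => ∑ r ∈ S, A r q) g hg G w = ∑ r ∈ S, holMul (A r) g hg G w := by
  simp only [holMul_apply, Finset.sum_add_distrib, LinearMap.sum_apply, Finsupp.sum,
    Finset.smul_sum]
  congr 1
  · refine Eq.trans (Finset.sum_congr rfl fun q _ => Finset.sum_comm) Finset.sum_comm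
  · refine Eq.trans (Finset.sum_congr rfl fun q _ => Finset.sum_comm) Finset.sum_comm

/-- When the holomorphic distribution comes from a polynomial, the product is ordinary
multiplication of the argument: the two terms of `holMul` account for the singular and the
polynomial part of tG. -/
lemma holMul_poly (t : ℂ[X]) (E : Module.End ℂ V) (g : Dist (Module.End ℂ V)) (hg : IsField g)
    (G : K) (w : V) :
    holMul (fun q => taylorCoeff q t • E) g hg G w = E (g (ofPoly t * G) w) := by
  obtain ⟨h, hh⟩ := exists_partialFractions (ofPoly t * G)
  -- The singular part of tG does not contribute to this trace, by `trace_polar_mul_polar`.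
  have htr : ∀ p, taylorCoeff p h = trace (polar p * (ofPoly t * G)) := by
    intro p
    rw [hh, mul_add, map_add, mul_comm _ (ofPoly h), trace_ofPoly_mul_polar, right_eq_add,
      Finsupp.linearCombination_apply, Finsupp.sum, Finset.mul_sum, map_sum]
    refine Finset.sum_eq_zero fun q _ => ?_
    rw [mul_smul_comm, map_smul, trace_polar_mul_polar, smul_zero]
  rw [hh, map_add, LinearMap.add_apply, map_add, holMul_apply]
  congr 1
  · rw [principalPart_ofPoly_mul]
    simp [Finsupp.sum, LinearMap.sum_apply, map_sum]
  · rw [field_apply_ofPoly g hg, Finsupp.sum, Finsupp.sum, map_sum]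
    refine Finset.sum_congr rfl fun p _ => ?_
    rw [map_smul, htr p, mul_left_comm, trace_ofPoly_mul, Finsupp.linearCombination_apply,
      Finsupp.sum, Finsupp.sum, Finset.sum_smul]
    refine Finset.sum_congr rfl fun q _ => ?_
    simp [mul_smul]

lemma holMul_poly_eventually (g : Dist (Module.End ℂ V)) (hg : IsField g) (G : K) (w : V) :
    ∀ᶠ n in Filter.atTop, ∀ (A : Idx → Module.End ℂ V) (t : ℂ[X]) (E : Module.End ℂ V),
      (∀ q ∈ box n, A q = taylorCoeff q t • E) → holMul A g hg G w = E (g (ofPoly t * G) w) := by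
  filter_upwards [holMul_congr_eventually g hg G w] with n hn A t E hA
  rw [hn A _ hA, holMul_poly]

lemma holMul_eventually (g : Dist (Module.End ℂ V)) (hg : IsField g) (G : K) (w : V) :
    ∀ᶠ n in Filter.atTop, ∀ A : Idx → Module.End ℂ V,
      holMul A g hg G w = ∑ q ∈ box n, A q (g (ofPoly (interp n q) * G) w) := by
  filter_upwards [holMul_congr_eventually g hg G w] with n hn A
  -- Only the values of A on the box matter, so A may be replaced by its interpolation, to which
  -- `holMul_poly` applies termwise.
  rw [hn A (fun q => ∑ r ∈ box n, taylorCoeff q (interp n r) • A r), holMul_sum]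
  · exact Finset.sum_congr rfl fun r _ => holMul_poly _ _ _ _ _ _
  · intro q hq
    rw [Finset.sum_eq_single q]
    · rw [taylorCoeff_interp hq hq, if_pos rfl, one_smul]
    · intro r hr hrq
      rw [taylorCoeff_interp hr hq, if_neg hrq, zero_smul]
    · exact fun h => absurd hq h

/-! ### Fields obtained from fields -/

lemma isField_holMul (A : Idx → Module.End ℂ V) (g : Dist (Module.End ℂ V)) (hg : IsField g) :
    IsField (holMul A g hg) := by
  refine isField_of_boxIdeal _ fun w => ?_
  obtain ⟨n, hn⟩ := (eventually_subset_box (singKernel g hg w).support).exists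
  refine ⟨n, fun t ht => ?_⟩
  rw [holMul_apply, principalPart_ofPoly, Finsupp.sum_zero_index, zero_add]
  refine Finset.sum_eq_zero fun p hp => ?_
  beta_reduce
  rw [mul_comm, principalPart_mul_eq_zero ht, Finsupp.sum_zero_index]
  rw [principalPart_polar]
  exact Finsupp.support_single_subset.trans (Finset.singleton_subset_iff.2 (hn hp))

lemma isField_mulLeft (g : Dist (Module.End ℂ V)) (hg : IsField g) (C : K) :
    IsField (g ∘ₗ LinearMap.mulLeft ℂ C) := by
  refine isField_of_boxIdeal _ fun w => ?_
  obtain ⟨n, hn⟩ := (field_eventually_eq_zero g hg C w).exists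
  refine ⟨n, fun t ht => ?_⟩
  rw [LinearMap.comp_apply, LinearMap.mulLeft_apply, mul_comm]
  exact hn t ht

lemma isField_contract (f : Dist (Module.End ℂ V)) (hf : IsField f)
    (E : Idx → Dist (Module.End ℂ V)) (hE : ∀ p, IsField (E p)) :
    IsField (contract f hf ∘ₗ LinearMap.pi E) := by
  refine isField_of_boxIdeal _ fun w => ?_
  obtain ⟨n, hn⟩ := ((Filter.eventually_all_finset (singKernel f hf w).support).2 fun p _ =>
    field_eventually_eq_zero (E p) (hE p) 1 (singKernel f hf w p)).exists
  refine ⟨n, fun t ht => ?_⟩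
  rw [LinearMap.comp_apply, contract_apply]
  refine Finset.sum_eq_zero fun p hp => ?_
  have := hn p hp t ht
  rwa [mul_one] at this

lemma IsField.add {f g : Dist (Module.End ℂ V)} (hf : IsField f) (hg : IsField g) :
    IsField (f + g) := fun v => by
  obtain ⟨R, hR⟩ := hf v
  obtain ⟨S, hS⟩ := hg v
  exact ⟨R + S, fun G => by
    simp only [LinearMap.add_apply, map_add, hR, hS]⟩

lemma IsField.sub {f g : Dist (Module.End ℂ V)} (hf : IsField f) (hg : IsField g) :
    IsField (f - g) := fun v => by
  obtain ⟨R, hR⟩ := hf v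
  obtain ⟨S, hS⟩ := hg v
  exact ⟨R - S, fun G => by
    simp only [LinearMap.sub_apply, map_sub, hR, hS]⟩

lemma isField_nopK (f g : Dist (Module.End ℂ V)) (hf : IsField f) (hg : IsField g) (F : K) :
    IsField (nopK f g hf hg F) :=
  (isField_holMul _ g hg).sub (isField_contract f hf _ fun _ => isField_mulLeft g hg _)

lemma isField_nopHat (f g : Dist (Module.End ℂ V)) (hf : IsField f) (hg : IsField g) (φ : HDual) :
    IsField (nopHat f g hf hg φ) :=
  (isField_holMul _ g hg).sub (isField_contract f hf _ fun _ => isField_holMul _ g hg)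

lemma isField_normalOrderedProduct (f g : Dist (Module.End ℂ V)) (hf : IsField f) (hg : IsField g)
    (F : KHat) : IsField (normalOrderedProduct f g hf hg F) :=
  (isField_nopHat f g hf hg _).add (isField_nopK f g hf hg _)

/-! ### The expansion of `F(τ₁ - τ₂)` in the second variable -/

lemma shiftTaylor_ofPoly (m : ℤ) (f : ℂ[X]) : shiftTaylor m (ofPoly f) =
    aeval (PowerSeries.C (tau + (m : K)) + PowerSeries.X : PowerSeries K) f := by
  exact IsLocalization.lift_eq _ _

lemma antipodeK_ofPoly (f : ℂ[X]) : antipodeK (ofPoly f) = ofPoly (f.comp (-X)) := by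
  have h1 : antipodeK (ofPoly f) = aeval (-tau) f := IsLocalization.lift_eq _ _
  rw [h1, comp_eq_aeval, ← aeval_algHom_apply, map_neg, ofPoly_X]

lemma K_ringHom_ext {A : Type*} [CommRing A] {φ ψ : K →+* A}
    (hC : ∀ c : ℂ, φ (ofPoly (C c)) = ψ (ofPoly (C c))) (hX : φ tau = ψ tau) : φ = ψ := by
  refine IsLocalization.ringHom_ext translates ?_
  exact Polynomial.ringHom_ext hC hX

/-- The Taylor expansion `F(τ - m - t) ∈ K[[t]]`. -/
def negShiftTaylor (m : ℤ) : K →+* PowerSeries K :=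
  (PowerSeries.rescale (-1 : K)).comp (shiftTaylor (-m) : K →+* PowerSeries K)

lemma coeff_negShiftTaylor (m : ℤ) (l : ℕ) (F : K) :
    PowerSeries.coeff l (negShiftTaylor m F) = actS (m, l) F := by
  rw [negShiftTaylor, RingHom.comp_apply, PowerSeries.coeff_rescale, actS, Algebra.smul_def,
    map_pow, map_neg, map_one]
  rfl

lemma rescale_C {R : Type*} [CommSemiring R] (a x : R) :
    PowerSeries.rescale a (PowerSeries.C x) = PowerSeries.C x := by
  ext n
  rw [PowerSeries.coeff_rescale, PowerSeries.coeff_C]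
  split_ifs with h <;> simp [h]

lemma negShiftTaylor_ofPoly (m : ℤ) (f : ℂ[X]) : negShiftTaylor m (ofPoly f) =
    aeval (PowerSeries.C (tau - (m : K)) - PowerSeries.X : PowerSeries K) f := by
  rw [negShiftTaylor, RingHom.comp_apply, RingHom.coe_coe, shiftTaylor_ofPoly]
  change ((PowerSeries.rescale (-1 : K)).comp (aeval _ : ℂ[X] →ₐ[ℂ] PowerSeries K).toRingHom) f =
    (aeval _ : ℂ[X] →ₐ[ℂ] PowerSeries K).toRingHom f
  congr 1
  refine Polynomial.ringHom_ext (fun c => ?_) ?_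
  · simp [IsScalarTower.algebraMap_apply ℂ K (PowerSeries K), PowerSeries.algebraMap_eq, rescale_C]
  · simp [sub_eq_add_neg, rescale_C]

lemma actS_mul (m : ℤ) (l : ℕ) (F G : K) : actS (m, l) (F * G) =
    ∑ ij ∈ Finset.HasAntidiagonal.antidiagonal l, actS (m, ij.1) F * actS (m, ij.2) G := by
  simp only [← coeff_negShiftTaylor, map_mul, PowerSeries.coeff_mul]

/-- Both sides are coefficients of ring homomorphisms on K, which agree on constants and on τ. With
this, the expansion in the second term of the normal ordered product becomes that of S(F)(τ₂ − τ₁) =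
F(τ₁ − τ₂). -/
lemma antipodeK_act (p : Idx) (F : K) : antipodeK (act p F) = actS p (antipodeK F) := by
  obtain ⟨m, l⟩ := p
  have h : (PowerSeries.map (antipodeK : K →+* K)).comp (shiftTaylor m : K →+* PowerSeries K) =
      (negShiftTaylor m).comp (antipodeK : K →+* K) := by
    refine K_ringHom_ext (fun c => ?_) ?_
    · simp only [RingHom.comp_apply, RingHom.coe_coe, antipodeK_ofPoly, C_comp, shiftTaylor_ofPoly,
        negShiftTaylor_ofPoly, aeval_C]
      rw [IsScalarTower.algebraMap_apply ℂ K (PowerSeries K), PowerSeries.algebraMap_eq,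
        PowerSeries.map_C, RingHom.coe_coe, AlgHom.commutes]
    · have h1 : antipodeK tau = -tau := by rw [← ofPoly_X, antipodeK_ofPoly, X_comp, map_neg]
      simp only [RingHom.comp_apply, RingHom.coe_coe, ← ofPoly_X, antipodeK_ofPoly, X_comp,
        shiftTaylor_ofPoly, negShiftTaylor_ofPoly, map_neg, aeval_X]
      rw [ofPoly_X, map_add, PowerSeries.map_C, PowerSeries.map_X, RingHom.coe_coe, map_add, h1,
        map_intCast, map_add, map_sub, map_neg]
      ring
  have h2 := congrArg (PowerSeries.coeff l) (RingHom.congr_fun h F)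
  rw [RingHom.comp_apply, RingHom.comp_apply, PowerSeries.coeff_map] at h2
  exact h2.trans (coeff_negShiftTaylor m l _)

/-! ### Polynomials in τ₂ over K and truncated expansions -/

/-- Polynomials in `τ₂` with coefficients in `K`, as elements of `K ⊗ K`. -/
def ofPolyRight : K[X] →ₐ[K] K ⊗[ℂ] K := aeval ((1 : K) ⊗ₜ[ℂ] tau)

lemma tmul_tau_pow (x : K) (j : ℕ) : x ⊗ₜ[ℂ] ofPoly (X ^ j) = ofPolyRight (C x * X ^ j) := by
  rw [map_mul, map_pow, map_pow, ofPolyRight, aeval_C, aeval_X, ofPoly_X,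
    Algebra.TensorProduct.tmul_pow, one_pow, Algebra.TensorProduct.algebraMap_apply,
    Algebra.TensorProduct.tmul_mul_tmul, mul_one, one_mul]
  rfl

lemma ofPolyRight_C_mul_map (x : K) (t : ℂ[X]) :
    ofPolyRight (C x * t.map (algebraMap ℂ K)) = x ⊗ₜ[ℂ] ofPoly t := by
  induction t using Polynomial.induction_on' with
  | add p q hp hq => rw [Polynomial.map_add, mul_add, map_add, hp, hq, map_add, tmul_add]
  | monomial j c =>
    have h1 : (monomial j c : ℂ[X]) = c • X ^ j := by rw [smul_X_eq_monomial]
    rw [map_monomial, h1, map_smul, tmul_smul, smul_tmul', tmul_tau_pow,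
      ← C_mul_X_pow_eq_monomial, ← mul_assoc, ← C_mul, Algebra.smul_def, mul_comm x]

lemma twistedCoproduct_eq (P : ℂ[X]) :
    twistedCoproduct P = ofPolyRight (aeval (C tau - X : K[X]) P) := by
  have h : twistedCoproduct = (ofPolyRight.restrictScalars ℂ).comp (aeval (C tau - X : K[X])) := by
    refine Polynomial.algHom_ext ?_
    simp only [twistedCoproduct, ofPolyRight, AlgHom.comp_apply, aeval_X,
      AlgHom.restrictScalars_apply, map_sub, aeval_C]
    rfl
  rw [h]; rfl

/-- The span of the elements `G ⊗ t` with `t` a polynomial sequence whose Taylor coefficients vanish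
on the box. -/
def boxTensor (n : ℕ) : Submodule ℂ (K ⊗[ℂ] K) :=
  Submodule.span ℂ {z | ∃ x : K, ∃ t ∈ boxIdeal n, z = x ⊗ₜ[ℂ] ofPoly t}

lemma taylor_C_mul_map_coeff (q : Idx) (x : K) (t : ℂ[X]) :
    (taylor (q.1 : K) (C x * t.map (algebraMap ℂ K))).coeff q.2 = taylorCoeff q t • x := by
  have h : taylor (q.1 : K) (t.map (algebraMap ℂ K)) = (taylor (q.1 : ℂ) t).map (algebraMap ℂ K) := by
    rw [map_taylor, map_intCast]
  rw [taylor_mul, taylor_C, h, coeff_C_mul, coeff_map, Algebra.smul_def, mul_comm]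
  rfl

lemma ofPolyRight_mem_boxTensor {n : ℕ} {x : K[X]}
    (hx : ∀ q ∈ box n, (taylor (q.1 : K) x).coeff q.2 = 0) : ofPolyRight x ∈ boxTensor n := by
  have hsum : x = ∑ j ∈ x.support, C (x.coeff j) * (X ^ j : ℂ[X]).map (algebraMap ℂ K) := by
    conv_lhs => rw [x.as_sum_support_C_mul_X_pow]
    simp
  have h0 : ∀ q ∈ box n, ∑ j ∈ x.support, taylorCoeff q (X ^ j) • x.coeff j = 0 := by
    intro q hq
    rw [← hx q hq]
    conv_rhs => rw [hsum]
    rw [map_sum, finsetSum_coeff]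
    exact Finset.sum_congr rfl fun j _ => (taylor_C_mul_map_coeff q _ _).symm
  have h1 : ofPolyRight x = ∑ j ∈ x.support, x.coeff j ⊗ₜ[ℂ] ofPoly
      (X ^ j - ∑ p ∈ box n, taylorCoeff p (X ^ j) • interp n p) := by
    conv_lhs => rw [hsum]
    simp only [map_sum, ofPolyRight_C_mul_map, map_sub, tmul_sub, Finset.sum_sub_distrib,
      tmul_sum, map_smul, tmul_smul]
    -- The interpolation corrections subtracted from the monomials add up to zero: collected along
    -- each `interp n p`, their coefficient is a Taylor coefficient of x on the box.
    rw [eq_comm, sub_eq_self, Finset.sum_comm]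
    refine Finset.sum_eq_zero fun p hp => ?_
    simp only [smul_tmul', ← sum_tmul]
    rw [h0 p hp, zero_tmul]
  rw [h1]
  exact Submodule.sum_mem _ fun j _ =>
    Submodule.subset_span ⟨_, _, sub_interp_mem_boxIdeal n _, rfl⟩

/-- The expansion of `F(τ₁ - τ₂)` at the integers in the variable `τ₂`, truncated to the box. -/
def expansion (n : ℕ) (F : K) : K ⊗[ℂ] K := ∑ q ∈ box n, actS q F ⊗ₜ[ℂ] ofPoly (interp n q)

/-- The truncated expansion has the same Taylor coefficients in τ₂ on the box as F(τ₁ − τ₂), so gF =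
f and the Leibniz rule `actS_mul` give equality of all coefficients on the box. -/
lemma twistedCoproduct_mul_expansion (n : ℕ) {F : K} {f g : ℂ[X]} (h : ofPoly g * F = ofPoly f) :
    twistedCoproduct g * expansion n F - twistedCoproduct f ∈ boxTensor n := by
  have h1 : expansion n F = ofPolyRight
      (∑ q ∈ box n, C (actS q F) * (interp n q).map (algebraMap ℂ K)) := by
    rw [map_sum]
    exact Finset.sum_congr rfl fun q _ => (ofPolyRight_C_mul_map _ _).symm
  have h2 : ∀ (P : ℂ[X]) (m : ℤ) (l : ℕ), (taylor (m : K) (aeval (C tau - X : K[X]) P)).coeff l =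
      actS (m, l) (ofPoly P) := by
    intro P m l
    rw [← coeff_negShiftTaylor, negShiftTaylor_ofPoly, ← Polynomial.coeff_coe]
    congr 1
    have h3 : (Polynomial.coeToPowerSeries.ringHom (R := K)).comp
        ((taylorAlgHom (m : K)).toRingHom.comp (aeval (C tau - X : K[X])).toRingHom) =
        (aeval (PowerSeries.C (tau - (m : K)) - PowerSeries.X : PowerSeries K) :
          ℂ[X] →ₐ[ℂ] PowerSeries K).toRingHom := by
      refine Polynomial.ringHom_ext (fun c => ?_) ?_
      · simp [IsScalarTower.algebraMap_apply ℂ K K[X],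
          IsScalarTower.algebraMap_apply ℂ K (PowerSeries K), PowerSeries.algebraMap_eq]
      · simp only [RingHom.comp_apply, AlgHom.toRingHom_eq_coe, RingHom.coe_coe, aeval_X,
          taylorAlgHom_apply, map_sub, taylor_C, taylor_X, map_add, coeToPowerSeries.ringHom_apply,
          Polynomial.coe_C, Polynomial.coe_X, map_intCast]
        ring
    exact RingHom.congr_fun h3 P
  have h4 : ∀ (m : ℤ) (l : ℕ), (m, l) ∈ box n → (taylor (m : K)
      (∑ q ∈ box n, C (actS q F) * (interp n q).map (algebraMap ℂ K))).coeff l = actS (m, l) F := by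
    intro m l hq
    rw [map_sum, finsetSum_coeff, Finset.sum_eq_single (m, l)]
    · rw [taylor_C_mul_map_coeff (m, l), taylorCoeff_interp hq hq, if_pos rfl, one_smul]
    · intro p hp hpq
      rw [taylor_C_mul_map_coeff (m, l), taylorCoeff_interp hp hq, if_neg hpq, zero_smul]
    · exact fun h => absurd hq h
  rw [h1, twistedCoproduct_eq, twistedCoproduct_eq, ← map_mul, ← map_sub]
  refine ofPolyRight_mem_boxTensor ?_
  rintro ⟨m, l⟩ hq
  rw [map_sub, taylor_mul, coeff_sub, coeff_mul, h2, ← h, actS_mul, sub_eq_zero]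
  refine Finset.sum_congr rfl fun ij hij => ?_
  rw [h2, h4 _ _ (box_lower (by have := Finset.HasAntidiagonal.mem_antidiagonal.1 hij; omega) hq)]

/-! ### Products of two distributions -/

/-- The distribution on `K ⊗ K` with value `f(F) g(G)` at `F ⊗ G`. -/
def prodDist (f g : Dist (Module.End ℂ V)) : K ⊗[ℂ] K →ₗ[ℂ] Module.End ℂ V :=
  TensorProduct.lift ((LinearMap.mul ℂ (Module.End ℂ V)).compl₁₂ f g)

@[simp]
lemma prodDist_tmul (f g : Dist (Module.End ℂ V)) (F G : K) :
    prodDist f g (F ⊗ₜ[ℂ] G) = f F * g G := rfl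

/-- The exchange of the two variables. -/
abbrev swap : K ⊗[ℂ] K ≃ₐ[ℂ] K ⊗[ℂ] K := Algebra.TensorProduct.comm ℂ K K

lemma commutator_eq (f g : Dist (Module.End ℂ V)) (z : K ⊗[ℂ] K) :
    commutator f g z = prodDist f g z - prodDist g f (swap z) := by
  induction z using TensorProduct.induction_on with
  | zero => simp
  | tmul x y => simp [commutator]
  | add x y hx hy => rw [map_add, map_add, map_add, map_add, hx, hy]; abel

lemma swap_twistedCoproduct (P : ℂ[X]) :
    swap (twistedCoproduct P) = twistedCoproduct (P.comp (-X)) := by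
  have h : (swap : K ⊗[ℂ] K →ₐ[ℂ] K ⊗[ℂ] K).comp twistedCoproduct =
      twistedCoproduct.comp (aeval (-X : ℂ[X])) := by
    refine Polynomial.algHom_ext ?_
    simp [twistedCoproduct]
  rw [comp_eq_aeval]
  exact AlgHom.congr_fun h P

lemma prodDist_boxTensor {n : ℕ} {f g : Dist (Module.End ℂ V)} {G : K} {w : V}
    (hn : ∀ t ∈ boxIdeal n, g (ofPoly t * G) w = 0) {z : K ⊗[ℂ] K} (hz : z ∈ boxTensor n) (H : K) :
    prodDist f g (z * H ⊗ₜ[ℂ] G) w = 0 := by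
  induction hz using Submodule.span_induction with
  | mem z hz =>
    obtain ⟨x, t, ht, rfl⟩ := hz
    rw [Algebra.TensorProduct.tmul_mul_tmul, prodDist_tmul, Module.End.mul_apply, hn t ht, map_zero]
  | zero => simp
  | add x y _ _ hx hy => rw [add_mul, map_add, LinearMap.add_apply, hx, hy, add_zero]
  | smul c x _ hx => rw [smul_mul_assoc, map_smul, LinearMap.smul_apply, hx, smul_zero]

/-- The distribution `N` is given by `f(τ₁) g(τ₂) R - g(τ₂) f(τ₁) L`, where `R` and `L` are limits of
two-variable rational functions that agree after multiplication by `p(τ₁ - τ₂)`. -/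
def IsRegularized (f g N : Dist (Module.End ℂ V)) (p : ℂ[X]) : Prop :=
  ∃ R L M : ℕ → K ⊗[ℂ] K,
    (∀ G w, ∀ᶠ n in Filter.atTop, N G w =
      prodDist f g (R n * 1 ⊗ₜ[ℂ] G) w - prodDist g f (swap (L n * 1 ⊗ₜ[ℂ] G)) w) ∧
    (∀ (H : ℂ[X]) G w, ∀ᶠ n in Filter.atTop,
      prodDist f g ((twistedCoproduct p * R n - M n) * ofPoly H ⊗ₜ[ℂ] G) w = 0) ∧
    (∀ (H : ℂ[X]) G w, ∀ᶠ n in Filter.atTop,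
      prodDist g f (swap ((twistedCoproduct p * L n - M n) * ofPoly H ⊗ₜ[ℂ] G)) w = 0)

/-- R and L are the expansions of one rational function in different variables; clearing the
denominator p makes both tend to r(τ₁ − τ₂). The errors lie in `boxTensor`, up to a swap for L, and
are killed by continuity of g and of f respectively. -/
lemma isRegularized_nopK (f g : Dist (Module.End ℂ V)) (hf : IsField f) (hg : IsField g) {F : K}
    {p r : ℂ[X]} (h : ofPoly p * F = ofPoly r) : IsRegularized f g (nopK f g hf hg F) p := by
  refine ⟨fun n => expansion n F, fun n => swap (expansion n (antipodeK F)),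
    fun _ => twistedCoproduct r, fun G w => ?_, fun H G w => ?_, fun H G w => ?_⟩
  · filter_upwards [holMul_eventually g hg G w, contract_eventually f hf w] with n h1 h2
    rw [nopK, LinearMap.sub_apply, LinearMap.sub_apply, h1, LinearMap.comp_apply, h2]
    congr 1
    · simp [expansion, Finset.sum_mul, LinearMap.sum_apply]
    · rw [map_mul]
      simp [expansion, Finset.sum_mul, LinearMap.sum_apply, antipodeK_act]
  · filter_upwards [field_eventually_eq_zero g hg G w] with n hn
    exact prodDist_boxTensor hn (twistedCoproduct_mul_expansion n h) _
  · filter_upwards [field_eventually_eq_zero f hf (ofPoly H) w] with n hn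
    have h1 : ofPoly (p.comp (-X)) * antipodeK F = ofPoly (r.comp (-X)) := by
      rw [← antipodeK_ofPoly, ← antipodeK_ofPoly, ← map_mul, h]
    have h2 := prodDist_boxTensor (f := g) hn (twistedCoproduct_mul_expansion n h1) G
    rw [← swap_twistedCoproduct, ← swap_twistedCoproduct] at h2
    have h3 : swap (swap (expansion n (antipodeK F))) = expansion n (antipodeK F) :=
      AlgEquiv.symm_apply_apply swap _
    rw [← h2, map_mul swap, map_sub swap, map_mul swap, h3]
    rfl

/-! ### Normal ordered products with elements of the dual of `Ĥ` -/

lemma hasseDeriv_map_ringHom {R S : Type*} [Semiring R] [Semiring S] (φ : R →+* S) (l : ℕ)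
    (B : R[X]) : hasseDeriv l (B.map φ) = (hasseDeriv l B).map φ := by
  ext n
  simp [hasseDeriv_coeff]

lemma actS_ofPoly (m : ℤ) (l : ℕ) (B : ℂ[X]) : actS (m, l) (ofPoly B) =
    ofPoly ((-1 : ℂ) ^ l • taylor (-m : ℂ) (hasseDeriv l B)) := by
  have h1 : (aeval (PowerSeries.C (tau + ((-m : ℤ) : K)) + PowerSeries.X : PowerSeries K) B) =
      ((taylor (tau + ((-m : ℤ) : K)) (B.map (algebraMap ℂ K)) : K[X]) : PowerSeries K) := by
    have h : (aeval (PowerSeries.C (tau + ((-m : ℤ) : K)) + PowerSeries.X : PowerSeries K) :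
        ℂ[X] →ₐ[ℂ] PowerSeries K).toRingHom = (Polynomial.coeToPowerSeries.ringHom (R := K)).comp
        ((taylorAlgHom (tau + ((-m : ℤ) : K))).toRingHom.comp (mapRingHom (algebraMap ℂ K))) := by
      refine Polynomial.ringHom_ext (fun c => ?_) ?_
      · simp [IsScalarTower.algebraMap_apply ℂ K (PowerSeries K), PowerSeries.algebraMap_eq]
      · simp only [RingHom.comp_apply, AlgHom.toRingHom_eq_coe, RingHom.coe_coe, aeval_X,
          taylorAlgHom_apply, taylor_X, map_add, coeToPowerSeries.ringHom_apply, coe_mapRingHom,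
          map_X, Polynomial.coe_C, Polynomial.coe_X]
        ring
    exact RingHom.congr_fun h B
  rw [actS, act, shiftTaylor_ofPoly, h1, Polynomial.coeff_coe, taylor_coeff, hasseDeriv_map_ringHom,
    eval_map_algebraMap, map_smul]
  congr 1
  have h2 : tau + ((-m : ℤ) : K) = ofPoly (X + C (-m : ℂ)) := by
    rw [map_add, ofPoly_X, ofPoly_C, map_neg, map_intCast, Int.cast_neg]
  rw [h2, aeval_algHom_apply, taylor_apply, comp_eq_aeval]

/-- The constant and the index shift are those of `transBasis_mul_antipodeH`, which is why a
functional on Ĥ can be replaced by a polynomial with matching Taylor coefficients. -/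
lemma taylorCoeff_actS (p : Idx) (m : ℤ) (l : ℕ) (B : ℂ[X]) :
    taylorCoeff p ((-1 : ℂ) ^ l • taylor (-m : ℂ) (hasseDeriv l B)) =
      ((-1) ^ l * ((p.2 + l).choose p.2 : ℂ)) * taylorCoeff (p.1 - m, p.2 + l) B := by
  rw [map_smul, taylorCoeff_apply, taylorCoeff_apply, taylor_taylor, taylor_coeff, taylor_coeff]
  have h := LinearMap.congr_fun (hasseDeriv_comp (R := ℂ) p.2 l) B
  rw [LinearMap.comp_apply] at h
  rw [h, LinearMap.smul_apply, eval_smul, nsmul_eq_mul, smul_eq_mul, mul_assoc]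
  congr 4
  push_cast
  ring

lemma taylorCoeff_comp_neg (m : ℤ) (l : ℕ) (B : ℂ[X]) :
    taylorCoeff (m, l) (B.comp (-X)) = (-1) ^ l * taylorCoeff (-m, l) B := by
  have h : taylor (m : ℂ) (B.comp (-X)) = (taylor (((-m : ℤ)) : ℂ) B).comp (C (-1) * X) := by
    rw [taylor_apply, taylor_apply, comp_assoc, comp_assoc]
    congr 1
    simp
    ring
  rw [taylorCoeff_apply, h, comp_C_mul_X_coeff, mul_comm]
  rfl

/-- The inclusion of the scalars in `Ĥ`. -/
def scalarH : ℂ →+* HHat := (C : LaurentPolynomial ℂ →+* HHat).comp LaurentPolynomial.C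

lemma smul_eq_scalarH_mul (c : ℂ) (h : HHat) : c • h = scalarH c * h := by
  rw [Algebra.smul_def]
  rfl

lemma transBasis_eq (r : Idx) : transBasis r =
    scalarH (r.2.factorial : ℂ)⁻¹ * C (LaurentPolynomial.T r.1) * X ^ r.2 := by
  rw [transBasis, LaurentPolynomial.smul_eq_C_mul, C_mul]
  rfl

lemma antipodeH_transBasis (r : Idx) : antipodeH (transBasis r) =
    scalarH ((-1) ^ r.2 * (r.2.factorial : ℂ)⁻¹) * C (LaurentPolynomial.T (-r.1)) * X ^ r.2 := by
  have h1 : (LaurentPolynomial.invert (R := ℂ)).toRingHom (LaurentPolynomial.T r.1) =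
    LaurentPolynomial.T (-r.1) := LaurentPolynomial.invert_T r.1
  have h2 : (LaurentPolynomial.invert (R := ℂ)).toRingHom
      (LaurentPolynomial.C (r.2.factorial : ℂ)⁻¹) = LaurentPolynomial.C (r.2.factorial : ℂ)⁻¹ :=
    LaurentPolynomial.invert_C _
  rw [antipodeH, transBasis, LaurentPolynomial.smul_eq_C_mul, Polynomial.map_mul, map_C, map_mul,
    h1, h2, Polynomial.map_pow, map_X, mul_comp, C_comp, pow_comp, X_comp, neg_pow (X : HHat),
    map_mul scalarH, map_pow scalarH, map_neg, map_one, C_mul]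
  change scalarH _ * _ * _ = _
  ring

lemma inv_factorial_mul_inv_factorial (i j : ℕ) : ((i.factorial : ℂ)⁻¹ * (j.factorial : ℂ)⁻¹) =
    ((i + j).choose i : ℂ) * ((i + j).factorial : ℂ)⁻¹ := by
  have h3 : ((i + j).choose i : ℂ) * i.factorial * j.factorial = (i + j).factorial := by
    have h2 := Nat.add_choose_mul_factorial_mul_factorial i j
    rw [← Nat.choose_symm_add] at h2
    exact_mod_cast h2
  have := Nat.cast_ne_zero (R := ℂ).2 (Nat.factorial_ne_zero i)
  have := Nat.cast_ne_zero (R := ℂ).2 (Nat.factorial_ne_zero j)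
  have := Nat.cast_ne_zero (R := ℂ).2 (Nat.factorial_ne_zero (i + j))
  field_simp
  rw [← h3]; ring

lemma transBasis_mul_antipodeH (p q : Idx) : transBasis p * antipodeH (transBasis q) =
    ((-1) ^ q.2 * ((p.2 + q.2).choose p.2 : ℂ)) • transBasis (p.1 - q.1, p.2 + q.2) := by
  have h := congrArg scalarH (inv_factorial_mul_inv_factorial p.2 q.2)
  rw [map_mul, map_mul] at h
  rw [smul_eq_scalarH_mul, antipodeH_transBasis, transBasis_eq, transBasis_eq, sub_eq_add_neg,
    LaurentPolynomial.T_add, C_mul, pow_add, map_mul, map_mul]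
  linear_combination (scalarH ((-1) ^ q.2) * C (LaurentPolynomial.T p.1) *
    C (LaurentPolynomial.T (-q.1)) * X ^ p.2 * X ^ q.2) * h

/-- The kernel of f at u has finite support, so only finitely many values of φ enter; a polynomial B
that matches φ at these indices gives the same result. -/
lemma evalHat_eventually (f : Dist (Module.End ℂ V)) (hf : IsField f) (φ : HDual) (q : Idx) (u : V) :
    ∀ᶠ n in Filter.atTop, ∀ B : ℂ[X], (∀ r ∈ box n, taylorCoeff r B = φ (transBasis r)) →
      evalHat f hf (φ ∘ₗ LinearMap.mulLeft ℂ (antipodeH (transBasis q))) u =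
        f (actS q (ofPoly B)) u := by
  filter_upwards [(Filter.eventually_all_finset (singKernel f hf u).support).2 fun p _ =>
    eventually_mem_box (p.1 - q.1, p.2 + q.2)] with n hn B hB
  obtain ⟨m, l⟩ := q
  rw [actS_ofPoly, field_apply_ofPoly f hf, evalHat, contract_apply]
  refine Finset.sum_congr rfl fun p hp => ?_
  beta_reduce
  rw [taylorCoeff_actS, hB _ (hn p hp), LinearMap.comp_apply, LinearMap.mulLeft_apply, mul_comm,
    transBasis_mul_antipodeH, map_smul, smul_eq_mul]
  rfl

lemma holMul_dual_eventually (g : Dist (Module.End ℂ V)) (hg : IsField g) (φ : HDual) (p : Idx)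
    (G : K) (u : V) :
    ∀ᶠ n in Filter.atTop, ∀ B : ℂ[X], (∀ r ∈ box n, taylorCoeff r B = φ (transBasis r)) →
      holMul (fun q => φ (transBasis p * antipodeH (transBasis q)) • LinearMap.id) g hg G u =
        g (actS p (ofPoly (B.comp (-X))) * G) u := by
  -- N fixes which coefficients matter to g; n is then taken large enough for the shifted indices to
  -- lie in the larger box.
  obtain ⟨N, hN⟩ := (holMul_poly_eventually g hg G u).exists
  filter_upwards [(Filter.eventually_all_finset (box N)).2 fun q _ =>
    eventually_mem_box (p.1 - q.1, p.2 + q.2)] with n hn B hB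
  obtain ⟨m, l⟩ := p
  rw [actS_ofPoly]
  refine hN _ _ LinearMap.id fun q hq => ?_
  rw [taylorCoeff_actS, transBasis_mul_antipodeH, map_smul, ← hB _ (hn q hq), taylorCoeff_comp_neg,
    smul_eq_mul, neg_sub, add_comm l q.2, Nat.choose_symm_add]
  congr 1
  rw [pow_add]
  have : ((-1 : ℂ) ^ l) * (-1) ^ l = 1 := by rw [← mul_pow]; simp
  linear_combination (-(-1) ^ q.2 * ((q.2 + l).choose l : ℂ) *
    taylorCoeff (m - q.1, q.2 + l) B) * this

lemma prodDist_twistedCoproduct (f g : Dist (Module.End ℂ V)) {n : ℕ} {G : K} {w : V}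
    (hn : ∀ t ∈ boxIdeal n, g (ofPoly t * G) w = 0) (B : ℂ[X]) :
    prodDist f g (twistedCoproduct B * 1 ⊗ₜ[ℂ] G) w =
      ∑ q ∈ box n, f (actS q (ofPoly B)) (g (ofPoly (interp n q) * G) w) := by
  have h := prodDist_boxTensor (f := f) hn
    (twistedCoproduct_mul_expansion n (F := ofPoly B) (f := B) (g := 1) (by simp)) 1
  rw [map_one, one_mul, sub_mul, map_sub, LinearMap.sub_apply, sub_eq_zero] at h
  rw [← h]
  simp [expansion, Finset.sum_mul, LinearMap.sum_apply]

/-- Two scales are used: N and N' truncate the two products to finite sums, and n is then so large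
that B represents φ in each of these finitely many terms. The sums for B are resummed to B(τ₁ − τ₂),
with no truncation left. -/
lemma nopHat_eventually (f g : Dist (Module.End ℂ V)) (hf : IsField f) (hg : IsField g) (φ : HDual)
    (G : K) (w : V) :
    ∀ᶠ n in Filter.atTop, ∀ B : ℂ[X], (∀ r ∈ box n, taylorCoeff r B = φ (transBasis r)) →
      nopHat f g hf hg φ G w = prodDist f g (twistedCoproduct B * 1 ⊗ₜ[ℂ] G) w -
        prodDist g f (swap (twistedCoproduct B * 1 ⊗ₜ[ℂ] G)) w := by
  obtain ⟨N, h1, h2⟩ := ((holMul_eventually g hg G w).and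
    (field_eventually_eq_zero g hg G w)).exists
  obtain ⟨N', h3, h4⟩ := ((contract_eventually f hf w).and
    (field_eventually_eq_zero f hf 1 w)).exists
  filter_upwards [(Filter.eventually_all_finset (box N)).2 fun q _ =>
      evalHat_eventually f hf φ q (g (ofPoly (interp N q) * G) w),
    (Filter.eventually_all_finset (box N')).2 fun p _ =>
      holMul_dual_eventually g hg φ p G (f (ofPoly (interp N' p)) w)] with n h5 h6 B hB
  rw [nopHat, LinearMap.sub_apply, LinearMap.sub_apply, h1, LinearMap.comp_apply, h3,
    prodDist_twistedCoproduct f g h2]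
  congr 1
  · exact Finset.sum_congr rfl fun q hq => h5 q hq B hB
  · have h7 := prodDist_boxTensor (f := g) h4 (twistedCoproduct_mul_expansion N'
      (F := ofPoly (B.comp (-X))) (f := B.comp (-X)) (g := 1) (by simp)) G
    rw [map_one, one_mul, sub_mul, map_sub, LinearMap.sub_apply, sub_eq_zero] at h7
    rw [map_mul, swap_twistedCoproduct]
    refine Eq.trans (Finset.sum_congr rfl fun p hp => h6 p hp B hB) (Eq.trans ?_ h7)
    simp [expansion, Finset.sum_mul, LinearMap.sum_apply]

lemma isRegularized_nopHat (f g : Dist (Module.End ℂ V)) (hf : IsField f) (hg : IsField g)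
    (φ : HDual) : IsRegularized f g (nopHat f g hf hg φ) 1 := by
  set B : ℕ → ℂ[X] := fun n => ∑ p ∈ box n, φ (transBasis p) • interp n p
  refine ⟨fun n => twistedCoproduct (B n), fun n => twistedCoproduct (B n),
    fun n => twistedCoproduct (B n), fun G w => ?_, fun H G w => ?_, fun H G w => ?_⟩
  · filter_upwards [nopHat_eventually f g hf hg φ G w] with n hn
    exact hn (B n) fun r hr => sum_taylorCoeff_interp (fun p => φ (transBasis p)) hr
  · simp
  · simp

/-! ### Dong's lemma -/

/-- Modulo the ideal, s and t are integral over ℂ, hence so is t − s; Q is a monic equation for it.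
This replaces the binomial expansion of (t − s)^N in the classical proof, where p and q are powers
of the variable. -/
lemma exists_aeval_sub_mem_span {A : Type*} [CommRing A] [Algebra ℂ A] (s t : A) {p q : ℂ[X]}
    (hp : p ≠ 0) (hq : q ≠ 0) :
    ∃ Q : ℂ[X], Q ≠ 0 ∧ aeval (t - s) Q ∈ Ideal.span {aeval s p, aeval t q} := by
  set I : Ideal A := Ideal.span {aeval s p, aeval t q}
  have hs : IsIntegral ℂ (Ideal.Quotient.mkₐ ℂ I s) := by
    refine IsAlgebraic.isIntegral ⟨p, hp, ?_⟩
    rw [aeval_algHom_apply, Ideal.Quotient.mkₐ_eq_mk, Ideal.Quotient.eq_zero_iff_mem]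
    exact Ideal.subset_span (by simp)
  have ht : IsIntegral ℂ (Ideal.Quotient.mkₐ ℂ I t) := by
    refine IsAlgebraic.isIntegral ⟨q, hq, ?_⟩
    rw [aeval_algHom_apply, Ideal.Quotient.mkₐ_eq_mk, Ideal.Quotient.eq_zero_iff_mem]
    exact Ideal.subset_span (by simp)
  obtain ⟨Q, hQ, h⟩ := ht.sub hs
  refine ⟨Q, hQ.ne_zero, ?_⟩
  rw [← map_sub, ← aeval_def, aeval_algHom_apply, Ideal.Quotient.mkₐ_eq_mk,
    Ideal.Quotient.eq_zero_iff_mem] at h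
  exact h

/-! ### The tensor cube and the six orderings of a, b, c -/

/-- The tensor cube of `K`. -/
abbrev K3 : Type := K ⊗[ℂ] (K ⊗[ℂ] K)

/-- The inclusion of `K ⊗ K` in the tensor cube in the first and second variables. -/
abbrev incl12 : K ⊗[ℂ] K →ₐ[ℂ] K3 :=
  Algebra.TensorProduct.map (AlgHom.id ℂ K) Algebra.TensorProduct.includeLeft

/-- The inclusion of `K ⊗ K` in the tensor cube in the first and third variables. -/
abbrev incl13 : K ⊗[ℂ] K →ₐ[ℂ] K3 :=
  Algebra.TensorProduct.map (AlgHom.id ℂ K) Algebra.TensorProduct.includeRight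

/-- The inclusion of `K ⊗ K` in the tensor cube in the second and third variables. -/
abbrev incl23 : K ⊗[ℂ] K →ₐ[ℂ] K3 := Algebra.TensorProduct.includeRight

/-- The exchange of the first two variables. -/
abbrev exch12 : K3 →ₗ[ℂ] K3 := (TensorProduct.leftComm ℂ K K K).toLinearMap

/-- The exchange of the last two variables. -/
abbrev exch23 : K3 →ₗ[ℂ] K3 := LinearMap.lTensor K (TensorProduct.comm ℂ K K).toLinearMap

/-- The distribution with value `f(F) g(G) h(H)` at `F ⊗ G ⊗ H`. -/
def prodDist3 (f g h : Dist (Module.End ℂ V)) : K3 →ₗ[ℂ] Module.End ℂ V :=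
  TensorProduct.lift ((LinearMap.mul ℂ (Module.End ℂ V)).compl₁₂ f (prodDist g h))

@[simp]
lemma prodDist3_tmul (f g h : Dist (Module.End ℂ V)) (x y z : K) :
    prodDist3 f g h (x ⊗ₜ[ℂ] (y ⊗ₜ[ℂ] z)) = f x * (g y * h z) := rfl

section Orders

variable (a b c : Dist (Module.End ℂ V))

/-- The distribution `a(τ₁) b(τ₂) c(τ₃)`. -/
abbrev dist123 : K3 →ₗ[ℂ] Module.End ℂ V := prodDist3 a b c

/-- The distribution `a(τ₁) c(τ₃) b(τ₂)`. -/
abbrev dist132 : K3 →ₗ[ℂ] Module.End ℂ V := prodDist3 a c b ∘ₗ exch23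

/-- The distribution `c(τ₃) a(τ₁) b(τ₂)`. -/
abbrev dist312 : K3 →ₗ[ℂ] Module.End ℂ V := prodDist3 c a b ∘ₗ exch12 ∘ₗ exch23

/-- The distribution `b(τ₂) a(τ₁) c(τ₃)`. -/
abbrev dist213 : K3 →ₗ[ℂ] Module.End ℂ V := prodDist3 b a c ∘ₗ exch12

/-- The distribution `b(τ₂) c(τ₃) a(τ₁)`. -/
abbrev dist231 : K3 →ₗ[ℂ] Module.End ℂ V := prodDist3 b c a ∘ₗ exch23 ∘ₗ exch12

/-- The distribution `c(τ₃) b(τ₂) a(τ₁)`. -/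
abbrev dist321 : K3 →ₗ[ℂ] Module.End ℂ V := prodDist3 c b a ∘ₗ exch12 ∘ₗ exch23 ∘ₗ exch12

lemma K3_induction {p : K3 → Prop} (zero : p 0) (tmul : ∀ x y z : K, p (x ⊗ₜ[ℂ] (y ⊗ₜ[ℂ] z)))
    (add : ∀ u v, p u → p v → p (u + v)) (u : K3) : p u := by
  induction u using TensorProduct.induction_on with
  | zero => exact zero
  | tmul x u =>
    induction u using TensorProduct.induction_on with
    | zero => rw [tmul_zero]; exact zero
    | tmul y z => exact tmul x y z
    | add u v hu hv => rw [tmul_add]; exact add _ _ hu hv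
  | add u v hu hv => exact add _ _ hu hv

variable {a b c}

/-- A linear identity between values at multiples of `ι u` follows from that for pure tensors `u`. -/
lemma forall_of_tmul {ι : K ⊗[ℂ] K →ₐ[ℂ] K3} {Φ : K3 →ₗ[ℂ] Module.End ℂ V} {x : K3}
    {Ψ : K ⊗[ℂ] K →ₗ[ℂ] Module.End ℂ V} (h : ∀ y z : K, Φ (ι (y ⊗ₜ[ℂ] z) * x) = Ψ (y ⊗ₜ[ℂ] z))
    (u : K ⊗[ℂ] K) : Φ (ι u * x) = Ψ u := by
  induction u using TensorProduct.induction_on with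
  | zero => simp
  | tmul y z => exact h y z
  | add u v hu hv => rw [map_add, add_mul, map_add, map_add, hu, hv]

lemma dist123_incl12_mul (u : K ⊗[ℂ] K) (x y z : K) :
    dist123 a b c (incl12 u * x ⊗ₜ[ℂ] (y ⊗ₜ[ℂ] z)) = prodDist a b (u * x ⊗ₜ[ℂ] y) * c z :=
  forall_of_tmul (Ψ := LinearMap.mulRight ℂ (c z) ∘ₗ prodDist a b ∘ₗ
    LinearMap.mulRight ℂ (x ⊗ₜ[ℂ] y)) (fun _ _ => by simp [mul_assoc]) u

lemma dist213_incl12_mul (u : K ⊗[ℂ] K) (x y z : K) :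
    dist213 a b c (incl12 u * x ⊗ₜ[ℂ] (y ⊗ₜ[ℂ] z)) =
      prodDist b a (swap (u * x ⊗ₜ[ℂ] y)) * c z :=
  forall_of_tmul (Ψ := LinearMap.mulRight ℂ (c z) ∘ₗ prodDist b a ∘ₗ swap.toLinearMap ∘ₗ
    LinearMap.mulRight ℂ (x ⊗ₜ[ℂ] y)) (fun _ _ => by simp [mul_assoc]) u

lemma dist312_incl12_mul (u : K ⊗[ℂ] K) (x y z : K) :
    dist312 a b c (incl12 u * x ⊗ₜ[ℂ] (y ⊗ₜ[ℂ] z)) = c z * prodDist a b (u * x ⊗ₜ[ℂ] y) :=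
  forall_of_tmul (Ψ := LinearMap.mulLeft ℂ (c z) ∘ₗ prodDist a b ∘ₗ
    LinearMap.mulRight ℂ (x ⊗ₜ[ℂ] y)) (fun _ _ => by simp) u

lemma dist321_incl12_mul (u : K ⊗[ℂ] K) (x y z : K) :
    dist321 a b c (incl12 u * x ⊗ₜ[ℂ] (y ⊗ₜ[ℂ] z)) =
      c z * prodDist b a (swap (u * x ⊗ₜ[ℂ] y)) :=
  forall_of_tmul (Ψ := LinearMap.mulLeft ℂ (c z) ∘ₗ prodDist b a ∘ₗ swap.toLinearMap ∘ₗ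
    LinearMap.mulRight ℂ (x ⊗ₜ[ℂ] y)) (fun _ _ => by simp) u

lemma dist_exchange {ι : K ⊗[ℂ] K →ₐ[ℂ] K3} {Φ Φ' : K3 →ₗ[ℂ] Module.End ℂ V} {u : K ⊗[ℂ] K}
    (h : ∀ x y z : K, Φ (ι u * x ⊗ₜ[ℂ] (y ⊗ₜ[ℂ] z)) = Φ' (ι u * x ⊗ₜ[ℂ] (y ⊗ₜ[ℂ] z))) (w : K3) :
    Φ (ι u * w) = Φ' (ι u * w) := by
  induction w using K3_induction with
  | zero => simp
  | tmul x y z => exact h x y z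
  | add w w' hw hw' => rw [mul_add, map_add, map_add, hw, hw']

lemma dist123_eq_dist213 {u : K ⊗[ℂ] K} (hu : ∀ z, commutator a b (u * z) = 0) (w : K3) :
    dist123 a b c (incl12 u * w) = dist213 a b c (incl12 u * w) := by
  refine dist_exchange (fun x y z => ?_) w
  have h := hu (x ⊗ₜ[ℂ] y)
  rw [commutator_eq, sub_eq_zero] at h
  rw [dist123_incl12_mul, dist213_incl12_mul, h]

lemma dist312_eq_dist321 {u : K ⊗[ℂ] K} (hu : ∀ z, commutator a b (u * z) = 0) (w : K3) :
    dist312 a b c (incl12 u * w) = dist321 a b c (incl12 u * w) := by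
  refine dist_exchange (fun x y z => ?_) w
  have h := hu (x ⊗ₜ[ℂ] y)
  rw [commutator_eq, sub_eq_zero] at h
  rw [dist312_incl12_mul, dist321_incl12_mul, h]

/-- Common form of the exchanges of c with a or b: Ψ is multiplication by the operator of the third
field, on the left or on the right, and r, s are the arguments already present. -/
lemma dist_exchange_of_commutator {f g : Dist (Module.End ℂ V)} {ι : K ⊗[ℂ] K →ₐ[ℂ] K3}
    {Φ Φ' : K3 →ₗ[ℂ] Module.End ℂ V} {u : K ⊗[ℂ] K} (hu : ∀ z, commutator f g (u * z) = 0)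
    (h : ∀ x y z : K, ∃ (r s : K) (Ψ : Module.End ℂ V →ₗ[ℂ] Module.End ℂ V), ∀ i j : K,
      Φ (ι (i ⊗ₜ[ℂ] j) * x ⊗ₜ[ℂ] (y ⊗ₜ[ℂ] z)) - Φ' (ι (i ⊗ₜ[ℂ] j) * x ⊗ₜ[ℂ] (y ⊗ₜ[ℂ] z)) =
        Ψ (f (i * r) * g (j * s) - g (j * s) * f (i * r))) (w : K3) :
    Φ (ι u * w) = Φ' (ι u * w) := by
  refine dist_exchange (fun x y z => ?_) w
  obtain ⟨r, s, Ψ, hΨ⟩ := h x y z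
  have h1 := forall_of_tmul (Φ := Φ - Φ') (ι := ι) (x := x ⊗ₜ[ℂ] (y ⊗ₜ[ℂ] z))
    (Ψ := Ψ ∘ₗ commutator f g ∘ₗ LinearMap.mulRight ℂ (r ⊗ₜ[ℂ] s)) (fun i j => by
      rw [LinearMap.sub_apply, hΨ]
      simp [commutator]) u
  rw [LinearMap.comp_apply, LinearMap.comp_apply, LinearMap.mulRight_apply, hu, map_zero,
    LinearMap.sub_apply, sub_eq_zero] at h1
  exact h1

lemma dist123_eq_dist132 {u : K ⊗[ℂ] K} (hu : ∀ z, commutator b c (u * z) = 0) (w : K3) :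
    dist123 a b c (incl23 u * w) = dist132 a b c (incl23 u * w) :=
  dist_exchange_of_commutator hu (fun x y z => ⟨y, z, LinearMap.mulLeft ℂ (a x), fun i j => by
    simp [mul_sub]⟩) w

lemma dist132_eq_dist312 {u : K ⊗[ℂ] K} (hu : ∀ z, commutator a c (u * z) = 0) (w : K3) :
    dist132 a b c (incl13 u * w) = dist312 a b c (incl13 u * w) :=
  dist_exchange_of_commutator hu (fun x y z => ⟨x, z, LinearMap.mulRight ℂ (b y), fun i j => by
    simp [sub_mul, mul_assoc]⟩) w

lemma dist213_eq_dist231 {u : K ⊗[ℂ] K} (hu : ∀ z, commutator a c (u * z) = 0) (w : K3) :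
    dist213 a b c (incl13 u * w) = dist231 a b c (incl13 u * w) :=
  dist_exchange_of_commutator hu (fun x y z => ⟨x, z, LinearMap.mulLeft ℂ (b y), fun i j => by
    simp [mul_sub]⟩) w

lemma dist231_eq_dist321 {u : K ⊗[ℂ] K} (hu : ∀ z, commutator b c (u * z) = 0) (w : K3) :
    dist231 a b c (incl23 u * w) = dist321 a b c (incl23 u * w) :=
  dist_exchange_of_commutator hu (fun x y z => ⟨y, z, LinearMap.mulRight ℂ (a x), fun i j => by
    simp [sub_mul, mul_assoc]⟩) w

end Orders

/-! ### Elements polynomial in τ₁ and the three differences -/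

/-- The elements of the tensor cube that are polynomial in the first variable. -/
abbrev KPoly3 : Type := ℂ[X] ⊗[ℂ] (K ⊗[ℂ] K)

/-- The map from `ℂ[X] ⊗ K ⊗ K` to the tensor cube. -/
abbrev inclPoly : KPoly3 →ₐ[ℂ] K3 :=
  Algebra.TensorProduct.map ofPoly (AlgHom.id ℂ (K ⊗[ℂ] K))

/-- The difference `τ₁ - τ₂`. -/
def diff12 : KPoly3 := X ⊗ₜ[ℂ] 1 - 1 ⊗ₜ[ℂ] (tau ⊗ₜ[ℂ] 1)

/-- The difference `τ₁ - τ₃`. -/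
def diff13 : KPoly3 := X ⊗ₜ[ℂ] 1 - 1 ⊗ₜ[ℂ] (1 ⊗ₜ[ℂ] tau)

lemma inclPoly_aeval_diff12 (P : ℂ[X]) : inclPoly (aeval diff12 P) = incl12 (twistedCoproduct P) := by
  have h : inclPoly.comp (aeval diff12) = incl12.comp twistedCoproduct := by
    refine Polynomial.algHom_ext ?_
    simp only [AlgHom.comp_apply, aeval_X, twistedCoproduct, diff12, map_sub,
      Algebra.TensorProduct.map_tmul, map_one]
    rfl
  exact AlgHom.congr_fun h P

lemma inclPoly_aeval_diff13 (P : ℂ[X]) : inclPoly (aeval diff13 P) = incl13 (twistedCoproduct P) := by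
  have h : inclPoly.comp (aeval diff13) = incl13.comp twistedCoproduct := by
    refine Polynomial.algHom_ext ?_
    simp only [AlgHom.comp_apply, aeval_X, twistedCoproduct, diff13, map_sub,
      Algebra.TensorProduct.map_tmul, map_one]
    rfl
  exact AlgHom.congr_fun h P

lemma inclPoly_aeval_sub (P : ℂ[X]) :
    inclPoly (aeval (diff13 - diff12) P) = incl23 (twistedCoproduct P) := by
  have h : inclPoly.comp (aeval (diff13 - diff12)) = incl23.comp twistedCoproduct := by
    refine Polynomial.algHom_ext ?_
    simp only [AlgHom.comp_apply, aeval_X, twistedCoproduct, diff12, diff13, map_sub,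
      Algebra.TensorProduct.map_tmul, map_one, Algebra.TensorProduct.includeRight_apply, AlgHom.id_apply]
    abel
  exact AlgHom.congr_fun h P

/-- The threshold for n depends on the pure tensor, but an element is a finite sum of these. -/
lemma eventually_eq_zero_of_tmul {Φ : K3 →ₗ[ℂ] Module.End ℂ V} {u : ℕ → K3} {v : V}
    (h : ∀ (H : ℂ[X]) (y z : K), ∀ᶠ n in Filter.atTop,
      Φ (u n * ofPoly H ⊗ₜ[ℂ] (y ⊗ₜ[ℂ] z)) v = 0) (x : KPoly3) :
    ∀ᶠ n in Filter.atTop, Φ (u n * inclPoly x) v = 0 := by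
  have hadd : ∀ x y : KPoly3, (∀ᶠ n in Filter.atTop, Φ (u n * inclPoly x) v = 0) →
      (∀ᶠ n in Filter.atTop, Φ (u n * inclPoly y) v = 0) →
      ∀ᶠ n in Filter.atTop, Φ (u n * inclPoly (x + y)) v = 0 := by
    intro x y hx hy
    filter_upwards [hx, hy] with n h1 h2
    rw [map_add, mul_add, map_add, LinearMap.add_apply, h1, h2, add_zero]
  induction x using TensorProduct.induction_on with
  | zero => simp
  | tmul H w =>
    induction w using TensorProduct.induction_on with
    | zero => simp
    | tmul y z => exact h H y z
    | add w w' hw hw' => rw [tmul_add]; exact hadd _ _ hw hw'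
  | add x y hx hy => exact hadd _ _ hx hy

/-- Dong's argument. All limits are taken at one fixed z and v, so a single large n serves for every
approximation involved. -/
theorem IsRegularized.mutuallyRational {a b c N : Dist (Module.End ℂ V)} {p : ℂ[X]} (hp : p ≠ 0)
    (hN : IsRegularized a b N p) (hab : MutuallyRational a b) (hac : MutuallyRational a c)
    (hbc : MutuallyRational b c) : MutuallyRational N c := by
  obtain ⟨Pab, hPab, hab⟩ := hab
  obtain ⟨Pac, hPac, hac⟩ := hac
  obtain ⟨Pbc, hPbc, hbc⟩ := hbc
  obtain ⟨R, L, M, hN, hR, hL⟩ := hN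
  -- The ideal is taken among elements polynomial in τ₁, so that the cofactors α and β are
  -- admissible in the limit conditions of `IsRegularized`.
  obtain ⟨Q, hQ, hQmem⟩ := exists_aeval_sub_mem_span diff12 diff13 (mul_ne_zero hp hPab) hPac
  obtain ⟨α, β, hαβ⟩ := Ideal.mem_span_pair.1 hQmem
  refine ⟨Q * Pbc, mul_ne_zero hQ hPbc, fun z => ?_⟩
  ext v
  rw [LinearMap.zero_apply]
  set E : ℕ → K3 →ₗ[ℂ] V := fun n =>
    LinearMap.applyₗ v ∘ₗ
      ((dist123 a b c - dist312 a b c) ∘ₗ LinearMap.mulLeft ℂ (incl12 (R n)) -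
       (dist213 a b c - dist321 a b c) ∘ₗ LinearMap.mulLeft ℂ (incl12 (L n))) with hE
  have hEapply : ∀ n w, E n w = dist123 a b c (incl12 (R n) * w) v -
      dist312 a b c (incl12 (R n) * w) v - (dist213 a b c (incl12 (L n) * w) v -
        dist321 a b c (incl12 (L n) * w) v) := fun n w => rfl
  have hcomm : ∀ y : K ⊗[ℂ] K, ∀ᶠ n in Filter.atTop, commutator N c y v = E n (incl23 y) := by
    intro y
    induction y using TensorProduct.induction_on with
    | zero => simp
    | tmul G H =>
      -- N is approximated at two vectors: c(H)v for the term N c, and v for the term c N.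
      filter_upwards [hN G (c H v), hN G v] with n h1 h2
      have h3 : incl23 (G ⊗ₜ[ℂ] H) = (1 : K) ⊗ₜ[ℂ] (G ⊗ₜ[ℂ] H) := rfl
      have h4 : commutator N c (G ⊗ₜ[ℂ] H) v = N G (c H v) - c H (N G v) := by simp [commutator]
      rw [h4, h1, h2, hEapply, h3, dist123_incl12_mul, dist213_incl12_mul, dist312_incl12_mul,
        dist321_incl12_mul, map_sub]
      simp only [Module.End.mul_apply]
      abel
    | add x y hx hy =>
      filter_upwards [hx, hy] with n h1 h2
      rw [map_add, LinearMap.add_apply, h1, h2, map_add, map_add]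
  set y : KPoly3 := aeval diff12 Pab * (α * Algebra.TensorProduct.includeRight
    (twistedCoproduct Pbc * z)) with hy
  have hjy : inclPoly y = incl12 (twistedCoproduct Pab) * inclPoly (α *
      Algebra.TensorProduct.includeRight (twistedCoproduct Pbc * z)) := by
    rw [hy, map_mul, inclPoly_aeval_diff12]
  have hincl : ∀ u : K ⊗[ℂ] K, inclPoly (Algebra.TensorProduct.includeRight u) = incl23 u := by
    intro u
    simp
  -- The multiplier splits along the two generators of the ideal; y collects P_ab, α and the
  -- remaining factors of the first term.
  have hdecomp : incl23 (twistedCoproduct (Q * Pbc) * z) =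
      incl12 (twistedCoproduct p) * inclPoly y +
        incl13 (twistedCoproduct Pac) * (incl23 (twistedCoproduct Pbc) *
          (inclPoly β * incl23 z)) := by
    rw [map_mul twistedCoproduct, mul_assoc, map_mul incl23, ← inclPoly_aeval_sub, ← hαβ, hjy,
      map_add, map_mul inclPoly β, map_mul inclPoly α, map_mul inclPoly α, map_mul (aeval diff12),
      map_mul inclPoly, hincl, inclPoly_aeval_diff13, inclPoly_aeval_diff12, inclPoly_aeval_diff12,
      map_mul incl23]
    ring
  have e1 := eventually_eq_zero_of_tmul (Φ := dist123 a b c) (v := v)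
    (u := fun n => incl12 (twistedCoproduct p * R n - M n)) (fun H G G' => by
      filter_upwards [hR H G (c G' v)] with n hn
      rw [dist123_incl12_mul, Module.End.mul_apply, hn]) y
  have e2 := eventually_eq_zero_of_tmul (Φ := dist312 a b c) (v := v)
    (u := fun n => incl12 (twistedCoproduct p * R n - M n)) (fun H G G' => by
      filter_upwards [hR H G v] with n hn
      rw [dist312_incl12_mul, Module.End.mul_apply, hn, map_zero]) y
  have e3 := eventually_eq_zero_of_tmul (Φ := dist213 a b c) (v := v)
    (u := fun n => incl12 (twistedCoproduct p * L n - M n)) (fun H G G' => by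
      filter_upwards [hL H G (c G' v)] with n hn
      rw [dist213_incl12_mul, Module.End.mul_apply, hn]) y
  have e4 := eventually_eq_zero_of_tmul (Φ := dist321 a b c) (v := v)
    (u := fun n => incl12 (twistedCoproduct p * L n - M n)) (fun H G G' => by
      filter_upwards [hL H G v] with n hn
      rw [dist321_incl12_mul, Module.End.mul_apply, hn, map_zero]) y
  obtain ⟨n, hn, e1, e2, e3, e4⟩ :=
    ((hcomm (twistedCoproduct (Q * Pbc) * z)).and (e1.and (e2.and (e3.and e4)))).exists
  rw [hn, hdecomp, map_add]
  have hsplit : ∀ (Φ : K3 →ₗ[ℂ] Module.End ℂ V) (S : K ⊗[ℂ] K),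
      Φ (incl12 (twistedCoproduct p * S - M n) * inclPoly y) v = 0 →
      Φ (incl12 S * (incl12 (twistedCoproduct p) * inclPoly y)) v = Φ (incl12 (M n) * inclPoly y) v := by
    intro Φ S h
    rw [map_sub incl12, sub_mul, map_sub Φ, LinearMap.sub_apply, sub_eq_zero] at h
    rw [← h, map_mul incl12]
    congr 2
    ring
  -- After R_n and L_n are replaced by the same M_n, the factor P_ab contained in y exchanges a and
  -- b, and the two differences cancel.
  have h1 : E n (incl12 (twistedCoproduct p) * inclPoly y) = 0 := by
    rw [hEapply, hsplit _ _ e1, hsplit _ _ e2, hsplit _ _ e3, hsplit _ _ e4, hjy,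
      mul_left_comm, dist123_eq_dist213 hab, dist312_eq_dist321 hab, sub_self]
  -- No limit is needed here: P_ac and P_bc carry c across a and b under any multiplier S in τ₁ and
  -- τ₂, so the terms with R_n and with L_n vanish separately.
  have h2 : ∀ w, E n (incl13 (twistedCoproduct Pac) * (incl23 (twistedCoproduct Pbc) * w)) = 0 := by
    intro w
    have h3 : ∀ S : K ⊗[ℂ] K, dist123 a b c (incl12 S * (incl13 (twistedCoproduct Pac) *
        (incl23 (twistedCoproduct Pbc) * w))) = dist312 a b c (incl12 S *
        (incl13 (twistedCoproduct Pac) * (incl23 (twistedCoproduct Pbc) * w))) := by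
      intro S
      rw [mul_left_comm (incl13 _), mul_left_comm (incl12 S), dist123_eq_dist132 hbc,
        mul_left_comm (incl12 S), mul_left_comm (incl23 _), dist132_eq_dist312 hac]
    have h4 : ∀ S : K ⊗[ℂ] K, dist213 a b c (incl12 S * (incl13 (twistedCoproduct Pac) *
        (incl23 (twistedCoproduct Pbc) * w))) = dist321 a b c (incl12 S *
        (incl13 (twistedCoproduct Pac) * (incl23 (twistedCoproduct Pbc) * w))) := by
      intro S
      rw [mul_left_comm (incl12 S), dist213_eq_dist231 hac, mul_left_comm (incl12 S),
        mul_left_comm (incl13 _), dist231_eq_dist321 hbc]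
    rw [hEapply, h3, h4, sub_self, sub_self, sub_self]
  rw [h1, h2, add_zero]

lemma MutuallyRational.add {f g c : Dist (Module.End ℂ V)} (hf : MutuallyRational f c)
    (hg : MutuallyRational g c) : MutuallyRational (f + g) c := by
  obtain ⟨P, hP, hf⟩ := hf
  obtain ⟨Q, hQ, hg⟩ := hg
  have hadd : ∀ z, commutator (f + g) c z = commutator f c z + commutator g c z := by
    intro z
    induction z using TensorProduct.induction_on with
    | zero => simp
    | tmul x y => simp [commutator, mul_add]; abel
    | add x y hx hy => rw [map_add, map_add, map_add, hx, hy]; abel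
  refine ⟨P * Q, mul_ne_zero hP hQ, fun z => ?_⟩
  rw [hadd, map_mul twistedCoproduct, mul_assoc, hf, mul_left_comm, hg, add_zero]

end

end HTVertex

theorem mainTheorem6 {V : Type*} [AddCommGroup V] [Module ℂ V]
    (a b c : HTVertex.Dist (Module.End ℂ V))
    (ha : HTVertex.IsField a) (hb : HTVertex.IsField b) (hc : HTVertex.IsField c)
    (hab : HTVertex.MutuallyRational a b) (hac : HTVertex.MutuallyRational a c)
    (hbc : HTVertex.MutuallyRational b c) (F : HTVertex.KHat) :
    HTVertex.IsField (HTVertex.normalOrderedProduct a b ha hb F) ∧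
      HTVertex.MutuallyRational (HTVertex.normalOrderedProduct a b ha hb F) c := by
  refine ⟨HTVertex.isField_normalOrderedProduct a b ha hb F, ?_⟩
  obtain ⟨f, g, hg, hF⟩ := HTVertex.exists_fraction (F.2 : HTVertex.K)
  -- The dual part needs no denominator; for the singular part p is the denominator of a fraction
  -- representing F.
  exact ((HTVertex.isRegularized_nopHat a b ha hb F.1).mutuallyRational one_ne_zero hab hac hbc).add
    ((HTVertex.isRegularized_nopK a b ha hb hF).mutuallyRational hg hab hac hbc)
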